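/- **Setting.** Let $\mathcal S\subset\mathbb R_+^N$ be a finite set of schedules such that every queue is served by some schedule: for each $n$ there is $\pi\in\mathcal S$ with $\pi_n>0$. Let $|x|=\max_n|x_n|$, and let $f:\mathbb R_+\to\mathbb R_+$ be continuous, differentiable on $(0,\infty)$ and strictly increasing with $f(0)=0$. Write $f(q)=(f(q_n))_n$, and assume scale invariance: for every $q\in\mathbb R_+^N$, every $\pi\in\mathcal S$ maximizing $\pi\cdot f(q)$ over $\mathcal S$ also maximizes $\pi\cdot f(\kappa q)$ over $\mathcal S$, for every $\kappa\ge 0$. The admissible region $\Lambda$ is the set of $\lambda\in\mathbb R_+^N$ with $\lambda\le\sigma$ componentwise for some $\sigma$ in the convex hull of $\mathcal S$. Let $\mathcal S^*$ (the virtual resources) be the set of extreme points of $\{\xi\in\mathbb R_+^N:\xi\cdot\pi\le1\ \forall\pi\in\mathcal S\}$ that are maximal among its extreme points for the componentwise order, and let $\Xi(\lambda)=\{\xi\in\mathcal S^*:\xi\cdot\lambda=1\}$. Put $F(x)=\int_0^xf(y)\,dy$ and $L(q)=\sum_nF(q_n)$. For $q\in\mathbb R_+^N$ let $\Delta(q)$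 be the minimizer of $L(r)$ over $r\in\mathbb R_+^N$ such that $\xi\cdot r\ge\xi\cdot q$ for all $\xi\in\Xi(\lambda)$, and $r_n\le q_n$ for all $n$ with $\lambda_n=0$. Let $I$ be a time interval $[0,T]$ with $0<T<\infty$, or $[0,\infty)$. A *fluid model solution* on $I$ with arrival rate $\lambda$, under the MW-$f$ policy, consists of functions $q,a,y:I\to\mathbb R_+^N$ and $s_\pi:I\to\mathbb R_+$ ($\pi\in\mathcal S$), all absolutely continuous on compact subintervals of $I$, with all $s_\pi$ and $y_n$ nondecreasing, such that for all $t\in I$ $$q(t)=q(0)+a(t)-\sum_\pi s_\pi(t)\pi+y(t),\quad a(t)=\lambda t,\quad \sum_\pi s_\pi(t)=t,\quad y(t)\le\sum_\pi s_\pi(t)\pi,$$ and such that at every interior time $t$ of $I$ where all components are differentiable, $\dot y_n(t)=0$ whenever $q_n(t)>0$, and $\dot s_\pi(t)=0$ whenever $\pi\cdot f(q(t))<\max_{\rho\in\mathcal S}\rho\cdot f(q(t))$. Call $q^0\in\mathbb R_+^N$ an *invariant state* (over $I$) if every fluid model solution on $I$ with $q(0)=q^0$ satisfies $q(t)=q^0$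 for all $t\in I$. **Theorem.** Let $\lambda\in\Lambda$. Then the minimizer $\Delta(q)$ exists and is unique for every $q\in\mathbb R_+^N$, and: (i) For every $K<\infty$, $\{q\in\mathbb R_+^N:L(q)\le K\}$ is compact. For every $I$ and every fluid model solution on $I$, $t\mapsto L(q(t))$ is nonincreasing on $I$; in particular $L(q(t))\le L(q(0))$. (ii) $\Delta:\mathbb R_+^N\to\mathbb R_+^N$ is continuous. (iii) $\Delta(\kappa q)=\kappa\Delta(q)$ for all $q\in\mathbb R_+^N$ and all $\kappa>0$. (iv) For every $I$ and every $q^0\in\mathbb R_+^N$: $q^0$ is an invariant state over $I$ if and only if $q^0=\Delta(q^0)$. (v) For every $\varepsilon>0$ there is $H_\varepsilon<\infty$ such that, for every $I$ and every fluid model solution on $I$ with $|q(0)|\le1$, $|q(t)-\Delta(q(t))|<\varepsilon$ for all $t\in I$ with $t\ge H_\varepsilon$. -/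

import Mathlib

open scoped ENNReal

noncomputable section

namespace SwitchedNetwork

variable {N : ℕ}

/-- `π` is a schedule of greatest weight `π ⬝ f(q)` among the schedules in `S`. -/
def IsMaxWeight (S : Finset (Fin N → ℝ)) (f : ℝ → ℝ) (q π : Fin N → ℝ) : Prop :=
  π ∈ S ∧ ∀ ρ ∈ S, ρ ⬝ᵥ (fun n => f (q n)) ≤ π ⬝ᵥ (fun n => f (q n))

/-- The standing assumption on the weight function `f : ℝ₊ → ℝ₊` of the MW-`f` policy
(only the values of `f` on `[0, ∞)` matter; they are nonnegative by `strictMono` and `zero`). -/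
structure WeightFunction (S : Finset (Fin N → ℝ)) (f : ℝ → ℝ) : Prop where
  continuous : ContinuousOn f (Set.Ici 0)
  differentiable : DifferentiableOn ℝ f (Set.Ioi 0)
  strictMono : StrictMonoOn f (Set.Ici 0)
  zero : f 0 = 0
  scale : ∀ q : Fin N → ℝ, 0 ≤ q → ∀ π : Fin N → ℝ, IsMaxWeight S f q π →
    ∀ κ : ℝ, 0 ≤ κ → IsMaxWeight S f (κ • q) π

/-- The admissible region `Λ`. -/
def admissibleRegion (S : Finset (Fin N → ℝ)) : Set (Fin N → ℝ) :=
  {lam | 0 ≤ lam ∧ ∃ σ ∈ convexHull ℝ (S : Set (Fin N → ℝ)), lam ≤ σ}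

/-- The feasible region of the dual of the static planning problem. -/
def dualFeasible (S : Finset (Fin N → ℝ)) : Set (Fin N → ℝ) :=
  {ξ | 0 ≤ ξ ∧ ∀ π ∈ S, ξ ⬝ᵥ π ≤ 1}

/-- Virtual resources: the maximal extreme points of the dual feasible region. -/
def virtualResources (S : Finset (Fin N → ℝ)) : Set (Fin N → ℝ) :=
  {ξ | ξ ∈ (dualFeasible S).extremePoints ℝ ∧
    ∀ ζ ∈ (dualFeasible S).extremePoints ℝ, ξ ≤ ζ → ξ = ζ}

/-- Critically loaded virtual resources. -/
def criticalResources (S : Finset (Fin N → ℝ)) (lam : Fin N → ℝ) : Set (Fin N → ℝ) :=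
  {ξ | ξ ∈ virtualResources S ∧ ξ ⬝ᵥ lam = 1}

/-- The Lyapunov function `L(q) = ∑ₙ F(qₙ)`, where `F(x) = ∫₀ˣ f(y) dy`. -/
def lyapunov (f : ℝ → ℝ) (q : Fin N → ℝ) : ℝ :=
  ∑ n, ∫ x in (0 : ℝ)..(q n), f x

/-- The feasible set of the optimization problem that defines the lifting map at `q`. -/
def liftFeasible (S : Finset (Fin N → ℝ)) (lam q : Fin N → ℝ) : Set (Fin N → ℝ) :=
  {r | 0 ≤ r ∧ (∀ ξ ∈ criticalResources S lam, ξ ⬝ᵥ q ≤ ξ ⬝ᵥ r) ∧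
    ∀ n, lam n = 0 → r n ≤ q n}

/-- `r` minimizes `L` over the feasible set at `q`. -/
def IsLiftOptimizer (S : Finset (Fin N → ℝ)) (lam : Fin N → ℝ) (f : ℝ → ℝ)
    (q r : Fin N → ℝ) : Prop :=
  r ∈ liftFeasible S lam q ∧ ∀ r' ∈ liftFeasible S lam q, lyapunov f r ≤ lyapunov f r'

/-- The lifting map: the optimizer of the problem at `q`. -/
def liftingMap (S : Finset (Fin N → ℝ)) (lam : Fin N → ℝ) (f : ℝ → ℝ)
    (q : Fin N → ℝ) : Fin N → ℝ :=
  Classical.epsilon (IsLiftOptimizer S lam f q)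

/-- The time interval `[0, T]` for finite `T`, and `[0, ∞)` for `T = ∞`. -/
def horizon (T : ℝ≥0∞) : Set ℝ := {t | 0 ≤ t ∧ ENNReal.ofReal t ≤ T}

/-- Regular times: interior times at which all components of `(q, a, y, s)` are
differentiable. -/
def IsRegularTime (S : Finset (Fin N → ℝ)) (T : ℝ≥0∞)
    (q a y : ℝ → Fin N → ℝ) (s : S → ℝ → ℝ) (t : ℝ) : Prop :=
  (0 < t ∧ ENNReal.ofReal t < T) ∧
  (∀ n, DifferentiableAt ℝ (fun u => q u n) t) ∧
  (∀ n, DifferentiableAt ℝ (fun u => a u n) t) ∧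
  (∀ n, DifferentiableAt ℝ (fun u => y u n) t) ∧
  ∀ π : S, DifferentiableAt ℝ (s π) t

/-- `(q, a, y, s)` is, on the time interval `horizon T`, a fluid model solution of the
single-hop switched network with schedules `S` and arrival rate `lam`, operating under the
MW-`f` policy. Only the values at times in `horizon T` matter. On an infinite horizon,
absolute continuity is meant on every compact time interval; it includes continuity. -/
structure IsFluidSolution (S : Finset (Fin N → ℝ)) (lam : Fin N → ℝ) (f : ℝ → ℝ)
    (T : ℝ≥0∞) (q a y : ℝ → Fin N → ℝ) (s : S → ℝ → ℝ) : Prop where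
  q_nonneg : ∀ t ∈ horizon T, 0 ≤ q t
  a_nonneg : ∀ t ∈ horizon T, 0 ≤ a t
  y_nonneg : ∀ t ∈ horizon T, 0 ≤ y t
  s_nonneg : ∀ π, ∀ t ∈ horizon T, 0 ≤ s π t
  queue : ∀ t ∈ horizon T, q t = q 0 + a t - ∑ π : S, s π t • (π : Fin N → ℝ) + y t
  arrivals : ∀ t ∈ horizon T, a t = t • lam
  busy : ∀ t ∈ horizon T, ∑ π : S, s π t = t
  littleIdle : ∀ t ∈ horizon T, y t ≤ ∑ π : S, s π t • (π : Fin N → ℝ)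
  s_mono : ∀ π, MonotoneOn (s π) (horizon T)
  y_mono : ∀ n, MonotoneOn (fun t => y t n) (horizon T)
  q_ac : ∀ n, ∀ t ∈ horizon T, AbsolutelyContinuousOnInterval (fun u => q u n) 0 t
  a_ac : ∀ n, ∀ t ∈ horizon T, AbsolutelyContinuousOnInterval (fun u => a u n) 0 t
  y_ac : ∀ n, ∀ t ∈ horizon T, AbsolutelyContinuousOnInterval (fun u => y u n) 0 t
  s_ac : ∀ π, ∀ t ∈ horizon T, AbsolutelyContinuousOnInterval (s π) 0 t
  idling : ∀ t, IsRegularTime S T q a y s t → ∀ n, 0 < q t n →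
    deriv (fun u => y u n) t = 0
  maxWeight : ∀ t, IsRegularTime S T q a y s t → ∀ π : S,
    (∃ ρ ∈ S, (π : Fin N → ℝ) ⬝ᵥ (fun n => f (q t n)) < ρ ⬝ᵥ (fun n => f (q t n))) →
    deriv (s π) t = 0

/-- `q0` is an invariant state (over the time interval `horizon T`): every fluid model solution
that starts at `q0` stays there. -/
def IsInvariantState (S : Finset (Fin N → ℝ)) (lam : Fin N → ℝ) (f : ℝ → ℝ)
    (T : ℝ≥0∞) (q0 : Fin N → ℝ) : Prop :=
  ∀ (q a y : ℝ → Fin N → ℝ) (s : S → ℝ → ℝ), IsFluidSolution S lam f T q a y s →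
    q 0 = q0 → ∀ t ∈ horizon T, q t = q0

end SwitchedNetwork

end

/-! Two facts drive everything. Strict convexity of `L` gives tangent inequalities, hence
first-order conditions and uniqueness of minimizers. The second is the duality lemma
`dotProduct_nonneg_of_critical`: a weight vector `u ≥ 0` for which `lam` is at least as heavy as
every schedule is a nonnegative multiple of a point of the face `ξ ⬝ lam = 1` of the dual polytope,
so it is controlled by the critical virtual resources.

Together they characterize the lift (`isLiftOptimizer_iff`): `r` is optimal at `q` exactly when it
is feasible, balanced (no schedule outweighs `lam` at `r`), and satisfies `f(r) ⬝ (r - q) = 0`. In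
particular, fixed points of the lift are the balanced states. Scale invariance of the policy
transports balance and the orthogonality relation from `r` to `κr`, which gives homogeneity.

Along a fluid solution `L(q)` decreases at least at the rate by which the heaviest schedule
outweighs `lam`, and the feasible set of the lifting problem shrinks, so `L(Δ(q))` can only grow.
Hence a fixed point cannot be left, and the gap `L(q) - L(Δ(q))` is nonincreasing. Compactness turns
"far from the lift" into a gap bounded below, and that into a uniform rate of decrease of `L`, which
cannot last.

Since invariance quantifies over all solutions, it would say nothing if there were none.
`exists_isFluidSolution` supplies one by an Euler scheme, passing to the limit along an ultrafilter.
-/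

noncomputable section

namespace SwitchedNetwork

open Set Filter Topology MeasureTheory

/-! ### Convexity and compactness for the Lyapunov function. -/

section

variable {N : ℕ} {S : Finset (Fin N → ℝ)} {f : ℝ → ℝ}

/-- The primitive of the weight function, extended to the real line. -/
def potential (f : ℝ → ℝ) (x : ℝ) : ℝ := ∫ y in (0 : ℝ)..x, f (max y 0)

/-- The vector of weights `f(q)`. -/
def weight (f : ℝ → ℝ) (q : Fin N → ℝ) : Fin N → ℝ := fun n => f (q n)

namespace WeightFunction

/-- Nothing is known about `f` at negative arguments; truncating them makes the potential
continuously differentiable on the whole line, so derivatives at empty queues need no one-sided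
treatment. -/
theorem continuous_extend (hf : WeightFunction S f) : Continuous fun y => f (max y 0) :=
  hf.continuous.comp_continuous (by fun_prop) fun y => le_max_right y 0

theorem hasDerivAt_potential (hf : WeightFunction S f) (x : ℝ) :
    HasDerivAt (potential f) (f (max x 0)) x :=
  intervalIntegral.integral_hasDerivAt_right (hf.continuous_extend.intervalIntegrable _ _)
    hf.continuous_extend.aestronglyMeasurable.stronglyMeasurableAtFilter
    hf.continuous_extend.continuousAt

theorem contDiff_potential (hf : WeightFunction S f) : ContDiff ℝ 1 (potential f) := by
  refine contDiff_one_iff_deriv.2 ⟨fun x => (hf.hasDerivAt_potential x).differentiableAt, ?_⟩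
  have : deriv (potential f) = fun x => f (max x 0) :=
    funext fun x => (hf.hasDerivAt_potential x).deriv
  rw [this]
  exact hf.continuous_extend

theorem continuous_potential (hf : WeightFunction S f) : Continuous (potential f) :=
  hf.contDiff_potential.continuous

theorem nonneg (hf : WeightFunction S f) {x : ℝ} (hx : 0 ≤ x) : 0 ≤ f x := by
  rw [← hf.zero]
  exact hf.strictMono.monotoneOn self_mem_Ici hx hx

theorem pos (hf : WeightFunction S f) {x : ℝ} (hx : 0 < x) : 0 < f x := by
  rw [← hf.zero]
  exact hf.strictMono self_mem_Ici hx.le hx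

theorem weight_nonneg (hf : WeightFunction S f) {q : Fin N → ℝ} (hq : 0 ≤ q) : 0 ≤ weight f q :=
  fun n => hf.nonneg (hq n)

theorem continuousOn_weight (hf : WeightFunction S f) :
    ContinuousOn (weight f) {q : Fin N → ℝ | 0 ≤ q} :=
  continuousOn_pi.2 fun n => hf.continuous.comp (continuous_apply n).continuousOn fun _ hq => hq n

theorem strictConvexOn_potential (hf : WeightFunction S f) :
    StrictConvexOn ℝ (Ici 0) (potential f) := by
  refine StrictMonoOn.strictConvexOn_of_deriv (convex_Ici 0) hf.continuous_potential.continuousOn ?_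
  intro x hx y hy hxy
  rw [interior_Ici] at hx hy
  rw [(hf.hasDerivAt_potential x).deriv, (hf.hasDerivAt_potential y).deriv,
    max_eq_left (le_of_lt hx), max_eq_left (le_of_lt hy)]
  exact hf.strictMono (mem_Ici.2 (le_of_lt hx)) (mem_Ici.2 (le_of_lt hy)) hxy

theorem potential_tangent_lt (hf : WeightFunction S f) {x y : ℝ} (hx : 0 ≤ x) (hy : 0 ≤ y)
    (hxy : x ≠ y) : potential f x + f x * (y - x) < potential f y := by
  have hd := hf.hasDerivAt_potential x
  rw [max_eq_left hx] at hd
  rcases lt_or_gt_of_ne hxy with h | h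
  · have := StrictConvexOn.lt_slope_of_hasDerivAt hf.strictConvexOn_potential hx hy h hd
    rw [slope_def_field, lt_div_iff₀ (by linarith)] at this
    linarith
  · have := StrictConvexOn.slope_lt_of_hasDerivAt hf.strictConvexOn_potential hy hx h hd
    rw [slope_def_field, div_lt_iff₀ (by linarith)] at this
    linarith

theorem potential_tangent_le (hf : WeightFunction S f) {x y : ℝ} (hx : 0 ≤ x) (hy : 0 ≤ y) :
    potential f x + f x * (y - x) ≤ potential f y := by
  rcases eq_or_ne x y with rfl | h
  · simp
  · exact (hf.potential_tangent_lt hx hy h).le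

theorem potential_nonneg (hf : WeightFunction S f) {x : ℝ} (hx : 0 ≤ x) : 0 ≤ potential f x := by
  have := hf.potential_tangent_le le_rfl hx
  simpa [potential, hf.zero] using this

end WeightFunction

theorem lyapunov_eq {q : Fin N → ℝ} (hq : 0 ≤ q) : lyapunov f q = ∑ n, potential f (q n) := by
  refine Finset.sum_congr rfl fun n _ => intervalIntegral.integral_congr fun x hx => ?_
  rw [uIcc_of_le (show (0 : ℝ) ≤ q n from hq n)] at hx
  simp [max_eq_left hx.1]

namespace WeightFunction

theorem continuousOn_lyapunov (hf : WeightFunction S f) :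
    ContinuousOn (lyapunov f) {q : Fin N → ℝ | 0 ≤ q} := by
  have h : Continuous fun q : Fin N → ℝ => ∑ n, potential f (q n) :=
    continuous_finsetSum _ fun n _ => hf.continuous_potential.comp (continuous_apply n)
  exact h.continuousOn.congr fun q hq => lyapunov_eq hq

theorem lyapunov_nonneg (hf : WeightFunction S f) {q : Fin N → ℝ} (hq : 0 ≤ q) :
    0 ≤ lyapunov f q := by
  rw [lyapunov_eq hq]
  exact Finset.sum_nonneg fun n _ => hf.potential_nonneg (hq n)

theorem lyapunov_tangent_lt (hf : WeightFunction S f) {r s : Fin N → ℝ} (hr : 0 ≤ r) (hs : 0 ≤ s)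
    (hrs : r ≠ s) : lyapunov f r + weight f r ⬝ᵥ (s - r) < lyapunov f s := by
  obtain ⟨m, hm⟩ := Function.ne_iff.1 hrs
  rw [lyapunov_eq hr, lyapunov_eq hs, dotProduct, ← Finset.sum_add_distrib]
  exact Finset.sum_lt_sum (fun n _ => hf.potential_tangent_le (hr n) (hs n))
    ⟨m, Finset.mem_univ m, hf.potential_tangent_lt (hr m) (hs m) hm⟩

theorem lyapunov_tangent_le (hf : WeightFunction S f) {r s : Fin N → ℝ} (hr : 0 ≤ r)
    (hs : 0 ≤ s) : lyapunov f r + weight f r ⬝ᵥ (s - r) ≤ lyapunov f s := by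
  rcases eq_or_ne r s with rfl | h
  · simp
  · exact (hf.lyapunov_tangent_lt hr hs h).le

theorem isCompact_sublevel (hf : WeightFunction S f) (K : ℝ) :
    IsCompact {q : Fin N → ℝ | 0 ≤ q ∧ lyapunov f q ≤ K} := by
  have hclosed : IsClosed {q : Fin N → ℝ | 0 ≤ q ∧ lyapunov f q ≤ K} :=
    hf.continuousOn_lyapunov.preimage_isClosed_of_isClosed isClosed_Ici isClosed_Iic
  refine (isCompact_Icc (a := (0 : Fin N → ℝ)) (b := fun _ => 1 + K / f 1)).of_isClosed_subset
    hclosed fun q hq => ⟨hq.1, fun n => ?_⟩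
  have hpos := hf.pos one_pos
  have h1 : potential f (q n) ≤ K := by
    refine le_trans ?_ hq.2
    rw [lyapunov_eq hq.1]
    exact Finset.single_le_sum (f := fun n => potential f (q n))
      (fun n _ => hf.potential_nonneg (hq.1 n)) (Finset.mem_univ n)
  -- The tangent is taken at `1` because the one at `0` is flat; slope `f 1 > 0` forces linear
  -- growth.
  have h2 := hf.potential_tangent_le zero_le_one (hq.1 n)
  have h3 := hf.potential_nonneg zero_le_one
  have h4 : q n - 1 ≤ K / f 1 := by
    rw [le_div_iff₀ hpos]
    linarith
  show q n ≤ 1 + K / f 1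
  linarith

/-- The directional derivative of the Lyapunov function is nonnegative towards any point at which
the segment does not go below the starting value. -/
theorem weight_dotProduct_nonneg_of_forall_le (hf : WeightFunction S f) {r s : Fin N → ℝ}
    (hr : 0 ≤ r) (hs : 0 ≤ s)
    (h : ∀ t ∈ Ioc (0 : ℝ) 1, lyapunov f r ≤ lyapunov f (r + t • (s - r))) :
    0 ≤ weight f r ⬝ᵥ (s - r) := by
  by_contra! hneg
  have hpath : ∀ t ∈ Icc (0 : ℝ) 1, 0 ≤ r + t • (s - r) := fun t ht n => by
    have h1 := mul_nonneg (sub_nonneg.2 ht.2) (hr n)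
    have h2 := mul_nonneg ht.1 (hs n)
    simp only [Pi.zero_apply, Pi.add_apply, Pi.smul_apply, Pi.sub_apply, smul_eq_mul] at h1 h2 ⊢
    linarith
  have hcont : ContinuousOn (fun t : ℝ => weight f (r + t • (s - r)) ⬝ᵥ (s - r)) (Icc 0 1) := by
    have h1 : ContinuousOn (fun t : ℝ => weight f (r + t • (s - r))) (Icc 0 1) :=
      hf.continuousOn_weight.comp (by fun_prop) hpath
    exact (Continuous.dotProduct continuous_id continuous_const).comp_continuousOn h1
  have h0 := hcont 0 ⟨le_rfl, zero_le_one⟩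
  have hev : ∀ᶠ t in 𝓝[Icc (0 : ℝ) 1] 0, weight f (r + t • (s - r)) ⬝ᵥ (s - r) < 0 :=
    h0.eventually_lt continuousWithinAt_const (by simpa using hneg)
  have hle : 𝓝[Ioc (0 : ℝ) 1] 0 ≤ 𝓝[Icc (0 : ℝ) 1] 0 := nhdsWithin_mono _ Ioc_subset_Icc_self
  have hne : (𝓝[Ioc (0 : ℝ) 1] 0).NeBot := by
    rw [← mem_closure_iff_nhdsWithin_neBot, closure_Ioc (zero_ne_one)]
    exact ⟨le_rfl, zero_le_one⟩
  obtain ⟨t, ht, htI⟩ := ((hev.filter_mono hle).and self_mem_nhdsWithin).exists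
  -- The tangent at the nearby point of the segment, evaluated back at `r`, shows that `L` has
  -- strictly dropped there, so `L` itself need not be differentiated.
  have h1 := hf.lyapunov_tangent_le (hpath t (Ioc_subset_Icc_self htI)) hr
  have h2 : r - (r + t • (s - r)) = -(t • (s - r)) := by abel
  rw [h2, dotProduct_neg, dotProduct_smul, smul_eq_mul] at h1
  have := h t htI
  nlinarith [htI.1, mul_neg_of_pos_of_neg htI.1 ht]

end WeightFunction

end

/-! ### The dual polytope and the critical virtual resources. -/

section

variable {N : ℕ} {S : Finset (Fin N → ℝ)} {f : ℝ → ℝ}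

theorem dotProduct_mono_left {u v w : Fin N → ℝ} (huv : u ≤ v) (hw : 0 ≤ w) :
    u ⬝ᵥ w ≤ v ⬝ᵥ w :=
  Finset.sum_le_sum fun n _ => mul_le_mul_of_nonneg_right (huv n) (hw n)

theorem dotProduct_mono_right {u v w : Fin N → ℝ} (huv : u ≤ v) (hw : 0 ≤ w) :
    w ⬝ᵥ u ≤ w ⬝ᵥ v :=
  Finset.sum_le_sum fun n _ => mul_le_mul_of_nonneg_left (huv n) (hw n)

theorem continuous_dotProduct_left (v : Fin N → ℝ) : Continuous fun u : Fin N → ℝ => u ⬝ᵥ v :=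
  Continuous.dotProduct continuous_id continuous_const

theorem continuous_dotProduct_right (v : Fin N → ℝ) : Continuous fun u : Fin N → ℝ => v ⬝ᵥ u :=
  Continuous.dotProduct continuous_const continuous_id

theorem isClosed_dualFeasible : IsClosed (dualFeasible S) := by
  have : dualFeasible S = Ici 0 ∩ ⋂ π ∈ S, {ξ | ξ ⬝ᵥ π ≤ 1} := by
    ext ξ; simp [dualFeasible]
  rw [this]
  exact isClosed_Ici.inter (isClosed_biInter fun π _ =>
    isClosed_le (continuous_dotProduct_left π) continuous_const)

theorem convex_dualFeasible : Convex ℝ (dualFeasible S) := by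
  rintro ξ ⟨hξ0, hξ⟩ ζ ⟨hζ0, hζ⟩ a b ha hb hab
  refine ⟨add_nonneg (smul_nonneg ha hξ0) (smul_nonneg hb hζ0), fun π hπ => ?_⟩
  rw [add_dotProduct, smul_dotProduct, smul_dotProduct, smul_eq_mul, smul_eq_mul]
  nlinarith [mul_le_mul_of_nonneg_left (hξ π hπ) ha, mul_le_mul_of_nonneg_left (hζ π hπ) hb]

theorem isCompact_dualFeasible (hS : ∀ π ∈ S, 0 ≤ π) (hserve : ∀ n, ∃ π ∈ S, 0 < π n) :
    IsCompact (dualFeasible S) := by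
  choose ρ hρS hρ using hserve
  refine (isCompact_Icc (a := (0 : Fin N → ℝ)) (b := fun n => 1 / ρ n n)).of_isClosed_subset
    isClosed_dualFeasible fun ξ hξ => ⟨hξ.1, fun n => ?_⟩
  show ξ n ≤ 1 / ρ n n
  rw [le_div_iff₀ (hρ n)]
  refine le_trans ?_ (hξ.2 _ (hρS n))
  exact Finset.single_le_sum (f := fun m => ξ m * ρ n m)
    (fun m _ => mul_nonneg (hξ.1 m) (hS _ (hρS n) m)) (Finset.mem_univ n)

/-- A slack constraint survives a small perturbation, and an active one survives if it moves the
right way. Finitely many constraints can then share one `ε`. -/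
theorem eventually_nonneg_add_mul {a b : ℝ} (ha : 0 ≤ a) (hab : a = 0 → 0 ≤ b) :
    ∀ᶠ ε in 𝓝[>] (0 : ℝ), 0 ≤ a + ε * b := by
  rcases ha.eq_or_lt with h | h
  · filter_upwards [self_mem_nhdsWithin] with ε hε
    rw [← h, zero_add]
    exact mul_nonneg (le_of_lt hε) (hab h.symm)
  · have hc : Continuous fun ε : ℝ => a + ε * b := by fun_prop
    have ht : Tendsto (fun ε : ℝ => a + ε * b) (𝓝[>] 0) (𝓝 a) := by
      simpa using (hc.tendsto 0).mono_left nhdsWithin_le_nhds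
    exact (ht.eventually (lt_mem_nhds h)).mono fun _ h => h.le

/-- An extreme point of the dual feasible region is determined by its active constraints. -/
theorem finite_extremePoints_dualFeasible : ((dualFeasible S).extremePoints ℝ).Finite := by
  let active : (Fin N → ℝ) → Set (Fin N) × Set S :=
    fun ξ => ({n | ξ n = 0}, {π | ξ ⬝ᵥ (π : Fin N → ℝ) = 1})
  refine Set.Finite.of_injOn (f := active) (t := univ) (mapsTo_univ _ _) ?_ (toFinite _)
  intro ξ hξ ζ hζ hact
  obtain ⟨⟨hξ0, hξ1⟩, hext⟩ := hξ
  have hζP := hζ.1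
  have hzero : ∀ n, ξ n = 0 → ζ n = 0 := fun n hn => by
    have : n ∈ (active ξ).1 := hn
    rwa [hact] at this
  have hone : ∀ π ∈ S, ξ ⬝ᵥ π = 1 → ζ ⬝ᵥ π = 1 := fun π hπ hn => by
    have : (⟨π, hπ⟩ : S) ∈ (active ξ).2 := hn
    rwa [hact] at this
  -- Constraints active at `ξ` are active at `ζ`, so the segment from `ζ` to `ξ` can be prolonged
  -- slightly beyond `ξ` inside the polytope; extremality of `ξ` then forces `ξ = ζ`.
  have hev1 : ∀ᶠ ε in 𝓝[>] (0 : ℝ), ∀ n, 0 ≤ ξ n + ε * (ξ n - ζ n) := by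
    exact eventually_all.2 fun n => eventually_nonneg_add_mul (hξ0 n) fun h => by
      simp [h, hzero n h]
  have hev2 : ∀ᶠ ε in 𝓝[>] (0 : ℝ), ∀ π : S, 0 ≤ 1 - ξ ⬝ᵥ (π : Fin N → ℝ) +
      ε * (ζ ⬝ᵥ (π : Fin N → ℝ) - ξ ⬝ᵥ (π : Fin N → ℝ)) := by
    refine eventually_all.2 fun π => eventually_nonneg_add_mul (sub_nonneg.2 (hξ1 π π.2)) fun h => ?_
    have h1 := (sub_eq_zero.1 h).symm
    simp [h1, hone π π.2 h1]
  obtain ⟨ε, ⟨h1, h2⟩, hε⟩ := ((hev1.and hev2).and self_mem_nhdsWithin).exists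
  replace hε : 0 < ε := hε
  have hmem : ξ + ε • (ξ - ζ) ∈ dualFeasible S := by
    refine ⟨fun n => h1 n, fun π hπ => ?_⟩
    have := h2 ⟨π, hπ⟩
    rw [add_dotProduct, smul_dotProduct, sub_dotProduct, smul_eq_mul]
    linarith
  have hseg : ξ ∈ openSegment ℝ (ξ + ε • (ξ - ζ)) ζ := by
    refine ⟨1 / (1 + ε), ε / (1 + ε), by positivity, by positivity, by field_simp, ?_⟩
    ext n
    simp only [Pi.add_apply, Pi.smul_apply, Pi.sub_apply, smul_eq_mul]
    field_simp
    ring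
  have heq := hext hmem hζP hseg
  ext n
  have := congrFun heq n
  simp only [Pi.add_apply, Pi.smul_apply, Pi.sub_apply, smul_eq_mul, add_eq_left,
    mul_eq_zero] at this
  rcases this with h | h <;> linarith

theorem exists_virtualResource_ge {ξ : Fin N → ℝ} (hξ : ξ ∈ (dualFeasible S).extremePoints ℝ) :
    ∃ ζ ∈ virtualResources S, ξ ≤ ζ := by
  obtain ⟨ζ, hle, hmax⟩ := finite_extremePoints_dualFeasible.exists_le_maximal hξ
  exact ⟨ζ, ⟨hmax.prop, fun η hη h => le_antisymm h (hmax.le_of_ge hη h)⟩, hle⟩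

theorem dotProduct_le_of_forall_le {lam u : Fin N → ℝ} (hlam : lam ∈ admissibleRegion S)
    (hu : 0 ≤ u) {c : ℝ} (h : ∀ π ∈ S, π ⬝ᵥ u ≤ c) : lam ⬝ᵥ u ≤ c := by
  obtain ⟨-, σ, hσ, hle⟩ := hlam
  refine (dotProduct_mono_left hle hu).trans ?_
  have hconv : Convex ℝ {σ : Fin N → ℝ | σ ⬝ᵥ u ≤ c} := by
    intro x hx y hy a b ha hb hab
    rw [mem_ofPred_eq] at hx hy ⊢
    rw [add_dotProduct, smul_dotProduct, smul_dotProduct, smul_eq_mul, smul_eq_mul]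
    calc a * (x ⬝ᵥ u) + b * (y ⬝ᵥ u) ≤ a * c + b * c := by gcongr
      _ = c := by rw [← add_mul, hab, one_mul]
  exact convexHull_min h hconv hσ

theorem dotProduct_le_one_of_mem_admissibleRegion {lam ξ : Fin N → ℝ}
    (hlam : lam ∈ admissibleRegion S) (hξ : ξ ∈ dualFeasible S) : ξ ⬝ᵥ lam ≤ 1 := by
  rw [dotProduct_comm]
  exact dotProduct_le_of_forall_le hlam hξ.1 fun π hπ => by
    rw [dotProduct_comm]
    exact hξ.2 π hπ

/-- Directions that do not decrease any critical workload, and do not increase any queue without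
arrivals, make a nonnegative angle with every weight vector for which `lam` has maximal weight. -/
theorem dotProduct_nonneg_of_critical (hS : ∀ π ∈ S, 0 ≤ π) (hserve : ∀ n, ∃ π ∈ S, 0 < π n)
    {lam : Fin N → ℝ} (hlam : lam ∈ admissibleRegion S) {u v : Fin N → ℝ} (hu : 0 ≤ u)
    (hmax : ∀ π ∈ S, π ⬝ᵥ u ≤ lam ⬝ᵥ u)
    (hcrit : ∀ ξ ∈ criticalResources S lam, 0 ≤ ξ ⬝ᵥ v) (hv : ∀ n, lam n = 0 → v n ≤ 0) :
    0 ≤ u ⬝ᵥ v := by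
  have hm0 : 0 ≤ lam ⬝ᵥ u := dotProduct_nonneg_of_nonneg hlam.1 hu
  rcases hm0.eq_or_lt with hm | hm
  -- If `lam` has zero weight then so does every schedule, and since every queue is served by some
  -- schedule, `u` vanishes.
  · have hu0 : u = 0 := by
      ext n
      obtain ⟨π, hπ, hpos⟩ := hserve n
      have h1 := hmax π hπ
      rw [← hm] at h1
      have h2 : π n * u n ≤ π ⬝ᵥ u := Finset.single_le_sum (f := fun m => π m * u m)
        (fun m _ => mul_nonneg (hS _ hπ m) (hu m)) (Finset.mem_univ n)
      have h3 := hu n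
      simp only [Pi.zero_apply] at h3 ⊢
      nlinarith
    simp [hu0]
  set P := dualFeasible S
  set G : Set (Fin N → ℝ) := {ξ | ξ ∈ P ∧ ξ ⬝ᵥ lam = 1}
  set u' : Fin N → ℝ := (lam ⬝ᵥ u)⁻¹ • u
  have hu'G : u' ∈ G := by
    refine ⟨⟨smul_nonneg (inv_nonneg.2 hm0) hu, fun π hπ => ?_⟩, ?_⟩
    · rw [smul_dotProduct, dotProduct_comm u π, smul_eq_mul, inv_mul_le_iff₀ hm, mul_one]
      exact hmax π hπ
    · rw [smul_dotProduct, dotProduct_comm u lam, smul_eq_mul, inv_mul_cancel₀ hm.ne']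
  -- `ξ ⬝ lam ≤ 1` holds throughout `P`, so `G` is a face, and its extreme points are extreme in
  -- `P`.
  have hGext : IsExtreme ℝ P G := by
    refine ⟨fun ξ hξ => hξ.1, fun x hx y hy z hz hzs => ⟨hx, ?_⟩⟩
    obtain ⟨a, b, ha, hb, hab, rfl⟩ := hzs
    have h1 := dotProduct_le_one_of_mem_admissibleRegion hlam hx
    have h2 := dotProduct_le_one_of_mem_admissibleRegion hlam hy
    have h3 := hz.2
    rw [add_dotProduct, smul_dotProduct, smul_dotProduct, smul_eq_mul, smul_eq_mul] at h3
    refine le_antisymm h1 ?_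
    by_contra! hlt
    nlinarith [mul_lt_mul_of_pos_left hlt ha, mul_le_mul_of_nonneg_left h2 hb.le]
  have hGclosed : IsClosed G := isClosed_dualFeasible.inter
    (isClosed_eq (continuous_dotProduct_left lam) continuous_const)
  have hGcompact : IsCompact G :=
    (isCompact_dualFeasible hS hserve).of_isClosed_subset hGclosed fun _ h => h.1
  have hGconv : Convex ℝ G := by
    rintro x ⟨hxP, hx⟩ y ⟨hyP, hy⟩ a b ha hb hab
    refine ⟨convex_dualFeasible hxP hyP ha hb hab, ?_⟩
    rw [add_dotProduct, smul_dotProduct, smul_dotProduct, hx, hy]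
    simpa using hab
  have hExt : ∀ ξ ∈ G.extremePoints ℝ, 0 ≤ ξ ⬝ᵥ v := by
    intro ξ hξ
    have hξP := hGext.extremePoints_subset_extremePoints hξ
    obtain ⟨ζ, hζ, hle⟩ := exists_virtualResource_ge hξP
    have hζ1 : ζ ⬝ᵥ lam = 1 :=
      le_antisymm (dotProduct_le_one_of_mem_admissibleRegion hlam hζ.1.1)
        (hξ.1.2.symm.le.trans (dotProduct_mono_left hle hlam.1))
    refine (hcrit ζ ⟨hζ, hζ1⟩).trans ?_
    -- Passing from `ξ` to the maximal `ζ` above it leaves the load at `1`, so they differ only at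
    -- queues without arrivals. There `v` is nonpositive, so `ξ ⬝ v` is no smaller than `ζ ⬝ v`.
    have hdiff : ∑ n, (ζ n - ξ n) * lam n = 0 := by
      have := hξ.1.2
      simp only [dotProduct] at this hζ1
      simp only [sub_mul, Finset.sum_sub_distrib, this, hζ1, sub_self]
    have hterm := (Finset.sum_eq_zero_iff_of_nonneg
      fun n _ => mul_nonneg (sub_nonneg.2 (hle n)) (hlam.1 n)).1 hdiff
    refine Finset.sum_le_sum fun n hn => ?_
    rcases mul_eq_zero.1 (hterm n hn) with h | h
    · rw [sub_eq_zero.1 h]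
    · nlinarith [hv n h, hle n]
  -- Krein–Milman carries the inequality from extreme points to all of `G`.
  have hsub : G ⊆ {ξ | 0 ≤ ξ ⬝ᵥ v} := by
    rw [← closure_convexHull_extremePoints hGcompact hGconv]
    refine closure_minimal (convexHull_min hExt ?_)
      (isClosed_le continuous_const (continuous_dotProduct_left v))
    intro x hx y hy a b ha hb hab
    rw [mem_ofPred_eq] at hx hy ⊢
    rw [add_dotProduct, smul_dotProduct, smul_dotProduct]
    exact add_nonneg (mul_nonneg ha hx) (mul_nonneg hb hy)
  have := hsub hu'G
  rw [mem_ofPred_eq, smul_dotProduct, smul_eq_mul] at this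
  exact nonneg_of_mul_nonneg_right this (inv_pos.2 hm)

end

/-! ### The lifting map: optimality conditions, homogeneity, continuity. -/

section

variable {N : ℕ} {S : Finset (Fin N → ℝ)} {f : ℝ → ℝ} {lam q r : Fin N → ℝ}

theorem self_mem_liftFeasible (hq : 0 ≤ q) : q ∈ liftFeasible S lam q :=
  ⟨hq, fun _ _ => le_rfl, fun _ _ => le_rfl⟩

theorem liftFeasible_subset (hr : r ∈ liftFeasible S lam q) :
    liftFeasible S lam r ⊆ liftFeasible S lam q := fun _ hs =>
  ⟨hs.1, fun ξ hξ => (hr.2.1 ξ hξ).trans (hs.2.1 ξ hξ), fun n hn => (hs.2.2 n hn).trans (hr.2.2 n hn)⟩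

theorem isClosed_liftFeasible : IsClosed (liftFeasible S lam q) := by
  have : liftFeasible S lam q = Ici 0 ∩ ((⋂ ξ ∈ criticalResources S lam, {r | ξ ⬝ᵥ q ≤ ξ ⬝ᵥ r}) ∩
      ⋂ n, ⋂ (_ : lam n = 0), {r | r n ≤ q n}) := by
    ext r; simp [liftFeasible]
  rw [this]
  refine isClosed_Ici.inter (IsClosed.inter ?_ ?_)
  · exact isClosed_biInter fun ξ _ => isClosed_le continuous_const (continuous_dotProduct_right ξ)
  · exact isClosed_iInter fun n => isClosed_iInter fun _ =>
      isClosed_le (continuous_apply n) continuous_const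

theorem convex_liftFeasible : Convex ℝ (liftFeasible S lam q) := by
  rintro x ⟨hx0, hx1, hx2⟩ y ⟨hy0, hy1, hy2⟩ a b ha hb hab
  refine ⟨add_nonneg (smul_nonneg ha hx0) (smul_nonneg hb hy0), fun ξ hξ => ?_, fun n hn => ?_⟩
  · rw [dotProduct_add, dotProduct_smul, dotProduct_smul, smul_eq_mul, smul_eq_mul]
    calc ξ ⬝ᵥ q = a * (ξ ⬝ᵥ q) + b * (ξ ⬝ᵥ q) := by rw [← add_mul, hab, one_mul]
      _ ≤ _ := by gcongr; exacts [hx1 ξ hξ, hy1 ξ hξ]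
  · calc a * x n + b * y n ≤ a * q n + b * q n := by gcongr; exacts [hx2 n hn, hy2 n hn]
      _ = q n := by rw [← add_mul, hab, one_mul]

theorem smul_mem_liftFeasible (hr : r ∈ liftFeasible S lam q) {κ : ℝ} (hκ : 0 ≤ κ) :
    κ • r ∈ liftFeasible S lam (κ • q) := by
  refine ⟨smul_nonneg hκ hr.1, fun ξ hξ => ?_, fun n hn => mul_le_mul_of_nonneg_left (hr.2.2 n hn) hκ⟩
  rw [dotProduct_smul, dotProduct_smul]
  exact mul_le_mul_of_nonneg_left (hr.2.1 ξ hξ) hκ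

/-- This makes the feasible sets lower semicontinuous: a competitor at one state is a limit of
competitors at nearby states, as the continuity proof needs. -/
theorem translate_mem_liftFeasible (hr : r ∈ liftFeasible S lam q) {p : Fin N → ℝ} (hp : 0 ≤ p) :
    (r + (p - q)) ⊔ 0 ∈ liftFeasible S lam p := by
  refine ⟨le_sup_right, fun ξ hξ => ?_, fun n hn => ?_⟩
  · have h1 := hr.2.1 ξ hξ
    have h2 : ξ ⬝ᵥ (r + (p - q)) ≤ ξ ⬝ᵥ ((r + (p - q)) ⊔ 0) :=
      dotProduct_mono_right le_sup_left hξ.1.1.1.1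
    rw [dotProduct_add, dotProduct_sub] at h2
    linarith
  · have h1 := hr.2.2 n hn
    refine max_le ?_ (hp n)
    simp only [Pi.add_apply, Pi.sub_apply]
    linarith

/-- The rate `lam` has at least the weight of every schedule, in state `q`. -/
def IsBalanced (S : Finset (Fin N → ℝ)) (lam : Fin N → ℝ) (f : ℝ → ℝ) (q : Fin N → ℝ) : Prop :=
  ∀ π ∈ S, π ⬝ᵥ weight f q ≤ lam ⬝ᵥ weight f q

/-- Let `σ ≥ lam` be a mixture of schedules. Balance squeezes the weight of `σ` to that of `lam`, so
every schedule in the mixture has maximal weight and `σ = lam` off the empty queues. Both facts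
persist under scaling: the first by scale invariance, the second because empty queues stay empty and
`f 0 = 0`. -/
theorem IsBalanced.smul (hf : WeightFunction S f) (hlam : lam ∈ admissibleRegion S) (hr : 0 ≤ r)
    (hbal : IsBalanced S lam f r) {κ : ℝ} (hκ : 0 ≤ κ) : IsBalanced S lam f (κ • r) := by
  intro π hπ
  obtain ⟨-, σ, hσ, hle⟩ := hlam
  obtain ⟨α, hα, hsum, rfl⟩ := (Finset.mem_convexHull').1 hσ
  set σ := ∑ ρ ∈ S, α ρ • ρ
  have hdot : ∀ u : Fin N → ℝ, σ ⬝ᵥ u = ∑ ρ ∈ S, α ρ * (ρ ⬝ᵥ u) := fun u => by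
    simp only [σ, sum_dotProduct, smul_dotProduct, smul_eq_mul]
  have hw := hf.weight_nonneg hr
  have h1 : lam ⬝ᵥ weight f r ≤ σ ⬝ᵥ weight f r := dotProduct_mono_left hle hw
  have h2 : 0 ≤ ∑ ρ ∈ S, α ρ * (lam ⬝ᵥ weight f r - ρ ⬝ᵥ weight f r) :=
    Finset.sum_nonneg fun ρ hρ => mul_nonneg (hα ρ hρ) (sub_nonneg.2 (hbal ρ hρ))
  have h3 : ∑ ρ ∈ S, α ρ * (lam ⬝ᵥ weight f r - ρ ⬝ᵥ weight f r) =
      lam ⬝ᵥ weight f r - σ ⬝ᵥ weight f r := by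
    rw [hdot]
    simp only [mul_sub, Finset.sum_sub_distrib, ← Finset.sum_mul, hsum, one_mul]
  have h4 : lam ⬝ᵥ weight f r = σ ⬝ᵥ weight f r := by linarith
  have hsched : ∀ ρ ∈ S, α ρ = 0 ∨ ρ ⬝ᵥ weight f r = lam ⬝ᵥ weight f r := fun ρ hρ => by
    have h5 := (Finset.sum_eq_zero_iff_of_nonneg fun ρ hρ =>
      mul_nonneg (hα ρ hρ) (sub_nonneg.2 (hbal ρ hρ))).1 (h3.trans (sub_eq_zero.2 h4)) ρ hρ
    exact (mul_eq_zero.1 h5).imp_right fun h => (sub_eq_zero.1 h).symm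
  have hqueue : ∀ n, σ n = lam n ∨ r n = 0 := fun n => by
    have h5 : ∑ n, (σ n - lam n) * weight f r n = 0 := by
      simp only [dotProduct] at h4
      simp only [sub_mul, Finset.sum_sub_distrib, h4, sub_self]
    have h6 := (Finset.sum_eq_zero_iff_of_nonneg fun n _ =>
      mul_nonneg (sub_nonneg.2 (hle n)) (hw n)).1 h5 n (Finset.mem_univ n)
    refine (mul_eq_zero.1 h6).imp sub_eq_zero.1 fun h => ?_
    by_contra hne
    exact (hf.pos (lt_of_le_of_ne (hr n) (Ne.symm hne))).ne' h
  have h5 : lam ⬝ᵥ weight f (κ • r) = σ ⬝ᵥ weight f (κ • r) := by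
    refine Finset.sum_congr rfl fun n _ => ?_
    rcases hqueue n with h | h
    · rw [h]
    · simp [weight, h, hf.zero]
  calc π ⬝ᵥ weight f (κ • r) = ∑ ρ ∈ S, α ρ * (π ⬝ᵥ weight f (κ • r)) := by
        rw [← Finset.sum_mul, hsum, one_mul]
    _ ≤ ∑ ρ ∈ S, α ρ * (ρ ⬝ᵥ weight f (κ • r)) := by
        refine Finset.sum_le_sum fun ρ hρ => ?_
        rcases hsched ρ hρ with h | h
        · simp [h]
        · exact mul_le_mul_of_nonneg_left
            ((hf.scale r hr ρ ⟨hρ, fun τ hτ => (hbal τ hτ).trans h.symm.le⟩ κ hκ).2 π hπ) (hα ρ hρ)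
    _ = lam ⬝ᵥ weight f (κ • r) := by rw [h5, hdot]

namespace WeightFunction

theorem exists_isLiftOptimizer (hf : WeightFunction S f) (hq : 0 ≤ q) :
    ∃ r, IsLiftOptimizer S lam f q r := by
  have hK := (hf.isCompact_sublevel (lyapunov f q)).inter_left
    (isClosed_liftFeasible (S := S) (lam := lam) (q := q))
  obtain ⟨r, hr, hmin⟩ := hK.exists_isMinOn ⟨q, self_mem_liftFeasible hq, hq, le_rfl⟩
    (hf.continuousOn_lyapunov.mono fun _ h => h.2.1)
  refine ⟨r, hr.1, fun s hs => ?_⟩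
  rcases le_total (lyapunov f s) (lyapunov f q) with h | h
  · exact hmin ⟨hs, hs.1, h⟩
  · exact hr.2.2.trans h

theorem weight_dotProduct_nonneg (hf : WeightFunction S f) (hr : IsLiftOptimizer S lam f q r)
    {s : Fin N → ℝ} (hs : s ∈ liftFeasible S lam q) : 0 ≤ weight f r ⬝ᵥ (s - r) := by
  refine hf.weight_dotProduct_nonneg_of_forall_le hr.1.1 hs.1 fun t ht => hr.2 _ ?_
  have := convex_liftFeasible hr.1 hs (sub_nonneg.2 ht.2) ht.1.le (sub_add_cancel 1 t)
  convert! this using 1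
  rw [smul_sub, sub_smul, one_smul]
  abel

theorem eq_of_isLiftOptimizer (hf : WeightFunction S f) {s : Fin N → ℝ}
    (hr : IsLiftOptimizer S lam f q r) (hs : IsLiftOptimizer S lam f q s) : s = r := by
  by_contra hne
  have h1 := hf.lyapunov_tangent_lt hr.1.1 hs.1.1 (Ne.symm hne)
  have h2 := hf.weight_dotProduct_nonneg hr hs.1
  have h3 := hs.2 r hr.1
  linarith

theorem isLiftOptimizer_liftingMap (hf : WeightFunction S f) (hq : 0 ≤ q) :
    IsLiftOptimizer S lam f q (liftingMap S lam f q) :=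
  Classical.epsilon_spec (hf.exists_isLiftOptimizer hq)

theorem eq_liftingMap (hf : WeightFunction S f) (hr : IsLiftOptimizer S lam f q r)
    (hq : 0 ≤ q) : r = liftingMap S lam f q :=
  hf.eq_of_isLiftOptimizer (hf.isLiftOptimizer_liftingMap hq) hr

/-- Serving by one schedule while `lam` arrives is a feasible direction: each critical workload
gains `1` and loses at most `1`. Optimality makes the derivative of `L` along it nonnegative. -/
theorem isBalanced_of_isLiftOptimizer (hf : WeightFunction S f) (hS : ∀ π ∈ S, 0 ≤ π)
    (hlam : lam ∈ admissibleRegion S) (hr : IsLiftOptimizer S lam f q r) :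
    IsBalanced S lam f r := by
  intro π hπ
  classical
  -- Service is cut off at empty queues to keep the perturbed state nonnegative; its weight is
  -- unaffected since `f 0 = 0`.
  let σ : Fin N → ℝ := fun n => if r n = 0 then 0 else π n
  have hσ0 : 0 ≤ σ := fun n => by
    simp only [σ]
    split_ifs
    exacts [le_rfl, hS π hπ n]
  have hσπ : σ ≤ π := fun n => by
    simp only [σ]
    split_ifs
    exacts [hS π hπ n, le_rfl]
  have hev : ∀ᶠ t in 𝓝[>] (0 : ℝ), ∀ n, 0 ≤ r n + t * (lam n - σ n) :=
    eventually_all.2 fun n => eventually_nonneg_add_mul (hr.1.1 n) fun h => by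
      simpa [σ, h] using hlam.1 n
  obtain ⟨t, ht, htpos⟩ := (hev.and self_mem_nhdsWithin).exists
  replace htpos : 0 < t := htpos
  have hmem : r + t • (lam - σ) ∈ liftFeasible S lam r := by
    refine ⟨ht, fun ξ hξ => ?_, fun n hn => ?_⟩
    · have h1 : ξ ⬝ᵥ σ ≤ 1 := (dotProduct_mono_right hσπ hξ.1.1.1.1).trans (hξ.1.1.1.2 π hπ)
      rw [dotProduct_add, dotProduct_smul, dotProduct_sub, hξ.2, smul_eq_mul]
      nlinarith
    · have := mul_nonneg htpos.le (hσ0 n)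
      simp only [Pi.add_apply, Pi.smul_apply, Pi.sub_apply, hn, smul_eq_mul]
      linarith
  have h1 := hf.weight_dotProduct_nonneg hr (liftFeasible_subset hr.1 hmem)
  rw [add_sub_cancel_left, dotProduct_smul, smul_eq_mul] at h1
  have h2 := nonneg_of_mul_nonneg_right h1 htpos
  have h3 : σ ⬝ᵥ weight f r = π ⬝ᵥ weight f r := by
    refine Finset.sum_congr rfl fun n _ => ?_
    by_cases h : r n = 0
    · simp [weight, h, hf.zero]
    · simp [σ, h]
  rw [dotProduct_comm, sub_dotProduct, h3] at h2
  linarith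

/-- These are Karush–Kuhn–Tucker conditions without explicit multipliers: by the duality lemma a
balanced `r` satisfies `f(r) ⬝ (s - q) ≥ 0` for all feasible `s`, and the orthogonality relation
turns this into `f(r) ⬝ (s - r) ≥ 0`. -/
theorem isLiftOptimizer_iff (hf : WeightFunction S f) (hS : ∀ π ∈ S, 0 ≤ π)
    (hserve : ∀ n, ∃ π ∈ S, 0 < π n) (hlam : lam ∈ admissibleRegion S) (hq : 0 ≤ q) :
    IsLiftOptimizer S lam f q r ↔
      r ∈ liftFeasible S lam q ∧ IsBalanced S lam f r ∧ weight f r ⬝ᵥ (r - q) = 0 := by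
  have key : IsBalanced S lam f r → 0 ≤ r → ∀ s ∈ liftFeasible S lam q,
      0 ≤ weight f r ⬝ᵥ (s - q) := fun hbal hr s hs =>
    dotProduct_nonneg_of_critical hS hserve hlam (hf.weight_nonneg hr) hbal
      (fun ξ hξ => by rw [dotProduct_sub]; exact sub_nonneg.2 (hs.2.1 ξ hξ))
      (fun n hn => sub_nonpos.2 (hs.2.2 n hn))
  constructor
  · intro h
    have hbal := hf.isBalanced_of_isLiftOptimizer hS hlam h
    refine ⟨h.1, hbal, le_antisymm ?_ (key hbal h.1.1 r h.1)⟩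
    have := hf.weight_dotProduct_nonneg h (self_mem_liftFeasible hq)
    rw [← neg_sub r q, dotProduct_neg] at this
    linarith
  · rintro ⟨hr, hbal, h0⟩
    refine ⟨hr, fun s hs => ?_⟩
    have h1 := hf.lyapunov_tangent_le hr.1 hs.1
    have h2 := key hbal hr.1 s hs
    have h3 : s - r = (s - q) - (r - q) := by abel
    rw [h3, dotProduct_sub, h0] at h1
    linarith

theorem eq_liftingMap_self_iff (hf : WeightFunction S f) (hS : ∀ π ∈ S, 0 ≤ π)
    (hserve : ∀ n, ∃ π ∈ S, 0 < π n) (hlam : lam ∈ admissibleRegion S) (hq : 0 ≤ q) :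
    q = liftingMap S lam f q ↔ IsBalanced S lam f q := by
  constructor
  · intro h
    have := hf.isLiftOptimizer_liftingMap (lam := lam) hq
    rw [← h] at this
    exact hf.isBalanced_of_isLiftOptimizer hS hlam this
  · intro h
    refine hf.eq_liftingMap ((hf.isLiftOptimizer_iff hS hserve hlam hq).2
      ⟨self_mem_liftFeasible hq, h, by simp⟩) hq

/-- Feasibility and balance scale, so only `f(κr) ⬝ (r - q) = 0` is left. One inequality is the
duality lemma for `f(κr)`; the other is the same lemma for `f(r) - ε f(κr)`, because `f(r) ⬝ (r - q)
= 0`. -/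
theorem liftingMap_smul (hf : WeightFunction S f) (hS : ∀ π ∈ S, 0 ≤ π)
    (hserve : ∀ n, ∃ π ∈ S, 0 < π n) (hlam : lam ∈ admissibleRegion S) (hq : 0 ≤ q)
    {κ : ℝ} (hκ : 0 < κ) :
    liftingMap S lam f (κ • q) = κ • liftingMap S lam f q := by
  have hκq : 0 ≤ κ • q := smul_nonneg hκ.le hq
  have hopt := hf.isLiftOptimizer_liftingMap (lam := lam) hq
  set r := liftingMap S lam f q
  obtain ⟨hmem, hbal, hcomp⟩ := (hf.isLiftOptimizer_iff hS hserve hlam hq).1 hopt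
  have hr := hmem.1
  have hκr : 0 ≤ κ • r := smul_nonneg hκ.le hr
  have hbal' := hbal.smul hf hlam hr hκ.le
  refine (hf.eq_liftingMap ((hf.isLiftOptimizer_iff hS hserve hlam hκq).2
    ⟨smul_mem_liftFeasible hmem hκ.le, hbal', ?_⟩) hκq).symm
  have key : ∀ u : Fin N → ℝ, 0 ≤ u → (∀ π ∈ S, π ⬝ᵥ u ≤ lam ⬝ᵥ u) → 0 ≤ u ⬝ᵥ (r - q) :=
    fun u hu hmax => dotProduct_nonneg_of_critical hS hserve hlam hu hmax
      (fun ξ hξ => by rw [dotProduct_sub]; exact sub_nonneg.2 (hmem.2.1 ξ hξ))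
      (fun n hn => sub_nonpos.2 (hmem.2.2 n hn))
  have hge := key _ (hf.weight_nonneg hκr) hbal'
  -- For small `ε` the vector `f(r) - ε f(κr)` stays admissible in the duality lemma: coordinates
  -- vanishing in `f(r)` vanish in `f(κr)`, and schedules tied with `lam` at `r` have maximal weight
  -- at `κr` by scale invariance.
  have hev1 : ∀ᶠ ε in 𝓝[>] (0 : ℝ), ∀ n, 0 ≤ weight f r n + ε * -weight f (κ • r) n := by
    refine eventually_all.2 fun n => eventually_nonneg_add_mul (hf.weight_nonneg hr n) fun h => ?_
    have hrn : r n = 0 := by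
      by_contra hne
      exact (hf.pos (lt_of_le_of_ne (hr n) (Ne.symm hne))).ne' h
    simp [weight, hrn, hf.zero]
  have hev2 : ∀ᶠ ε in 𝓝[>] (0 : ℝ), ∀ π : S,
      0 ≤ (lam ⬝ᵥ weight f r - (π : Fin N → ℝ) ⬝ᵥ weight f r) +
        ε * ((π : Fin N → ℝ) ⬝ᵥ weight f (κ • r) - lam ⬝ᵥ weight f (κ • r)) := by
    refine eventually_all.2 fun π => eventually_nonneg_add_mul (sub_nonneg.2 (hbal π π.2)) fun h => ?_
    have hmax : IsMaxWeight S f r π := ⟨π.2, fun ρ hρ => (hbal ρ hρ).trans (sub_eq_zero.1 h).le⟩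
    exact sub_nonneg.2 (dotProduct_le_of_forall_le hlam (hf.weight_nonneg hκr)
      (hf.scale r hr π hmax κ hκ.le).2)
  obtain ⟨ε, ⟨h1, h2⟩, hε⟩ := ((hev1.and hev2).and self_mem_nhdsWithin).exists
  replace hε : 0 < ε := hε
  have hle := key (weight f r - ε • weight f (κ • r))
    (fun n => by
      have := h1 n
      simp only [Pi.zero_apply, Pi.sub_apply, Pi.smul_apply, smul_eq_mul]
      linarith)
    (fun π hπ => by
      have := h2 ⟨π, hπ⟩
      simp only [dotProduct_sub, dotProduct_smul, smul_eq_mul]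
      linarith)
  rw [sub_dotProduct, smul_dotProduct, hcomp, zero_sub, smul_eq_mul, neg_nonneg] at hle
  have hzero : weight f (κ • r) ⬝ᵥ (r - q) = 0 := by
    refine le_antisymm ?_ hge
    by_contra! hpos
    exact absurd (mul_pos hε hpos) (not_lt.2 hle)
  rw [← smul_sub, dotProduct_smul, hzero, smul_zero]

theorem lyapunov_liftingMap_le (hf : WeightFunction S f) (hq : 0 ≤ q) :
    lyapunov f (liftingMap S lam f q) ≤ lyapunov f q :=
  (hf.isLiftOptimizer_liftingMap hq).2 q (self_mem_liftFeasible hq)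

/-- Along an ultrafilter converging to `p`, the optimizers remain in a compact sublevel set and so
converge. Their limit is feasible at `p` and, by comparison with translated competitors, optimal, so
uniqueness identifies it. -/
theorem continuousOn_liftingMap (hf : WeightFunction S f) :
    ContinuousOn (liftingMap S lam f) {q | 0 ≤ q} := by
  intro p hp
  rw [ContinuousWithinAt, tendsto_iff_ultrafilter]
  intro g hg
  have hgp : Tendsto id (g : Filter (Fin N → ℝ)) (𝓝 p) := hg.trans nhdsWithin_le_nhds
  have hgpos : ∀ᶠ q in (g : Filter (Fin N → ℝ)), 0 ≤ q := hg self_mem_nhdsWithin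
  have hL : Tendsto (lyapunov f) g (𝓝 (lyapunov f p)) :=
    (hf.continuousOn_lyapunov p hp).mono_left hg
  have hmemK : ∀ᶠ q in (g : Filter (Fin N → ℝ)), liftingMap S lam f q ∈
      {r : Fin N → ℝ | 0 ≤ r ∧ lyapunov f r ≤ lyapunov f p + 1} := by
    filter_upwards [hgpos, hL.eventually (ge_mem_nhds (lt_add_one (lyapunov f p)))] with q hq h
    exact ⟨(hf.isLiftOptimizer_liftingMap hq).1.1, (hf.lyapunov_liftingMap_le hq).trans h⟩
  obtain ⟨r, hrK, hr⟩ := (hf.isCompact_sublevel (lyapunov f p + 1)).ultrafilter_le_nhds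
    (g.map (liftingMap S lam f)) (le_principal_iff.2 hmemK)
  have hrt : Tendsto (liftingMap S lam f) g (𝓝 r) := hr
  have hrL : Tendsto (fun q => lyapunov f (liftingMap S lam f q)) g (𝓝 (lyapunov f r)) :=
    (hf.continuousOn_lyapunov r hrK.1).tendsto.comp
      (tendsto_nhdsWithin_iff.2 ⟨hrt, hmemK.mono fun _ h => h.1⟩)
  have hopt : IsLiftOptimizer S lam f p r := by
    refine ⟨⟨hrK.1, fun ξ hξ => ?_, fun n hn => ?_⟩, fun s hs => ?_⟩
    · refine le_of_tendsto_of_tendsto (((continuous_dotProduct_right ξ).tendsto p).comp hgp)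
        (((continuous_dotProduct_right ξ).tendsto r).comp hrt) ?_
      filter_upwards [hgpos] with q hq
      exact (hf.isLiftOptimizer_liftingMap hq).1.2.1 ξ hξ
    · refine le_of_tendsto_of_tendsto (((continuous_apply n).tendsto r).comp hrt)
        (((continuous_apply n).tendsto p).comp hgp) ?_
      filter_upwards [hgpos] with q hq
      exact (hf.isLiftOptimizer_liftingMap hq).1.2.2 n hn
    · have hcont : Continuous fun q : Fin N → ℝ => (s + (q - p)) ⊔ 0 :=
        continuous_pi fun n => Continuous.max (by fun_prop) continuous_const
      have ht : Tendsto (fun q : Fin N → ℝ => (s + (q - p)) ⊔ 0) g (𝓝 s) := by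
        have := (hcont.tendsto p).comp hgp
        rwa [sub_self, add_zero, sup_eq_left.2 hs.1] at this
      have hsL : Tendsto (fun q => lyapunov f ((s + (q - p)) ⊔ 0)) g (𝓝 (lyapunov f s)) :=
        (hf.continuousOn_lyapunov s hs.1).tendsto.comp
          (tendsto_nhdsWithin_iff.2 ⟨ht, Eventually.of_forall fun q => show 0 ≤ (s + (q - p)) ⊔ 0 from le_sup_right⟩)
      refine le_of_tendsto_of_tendsto hrL hsL ?_
      filter_upwards [hgpos] with q hq
      exact (hf.isLiftOptimizer_liftingMap hq).2 _ (translate_mem_liftFeasible hs hq)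
  rwa [hf.eq_liftingMap hopt hp] at hrt

end WeightFunction

end

/-! ### Fluid solutions: Lyapunov decrease, invariant states, uniform convergence. -/

section

variable {N : ℕ} {S : Finset (Fin N → ℝ)} {f : ℝ → ℝ} {lam : Fin N → ℝ} {T : ℝ≥0∞}

/-- The inner function is bounded on the interval, and `G` is Lipschitz on bounded sets. -/
theorem absolutelyContinuousOnInterval_comp_of_contDiff {G g : ℝ → ℝ} {a b : ℝ}
    (hG : ContDiff ℝ 1 G) (hg : AbsolutelyContinuousOnInterval g a b) :
    AbsolutelyContinuousOnInterval (fun t => G (g t)) a b := by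
  obtain ⟨C, hC⟩ := hg.exists_bound
  obtain ⟨K, hK⟩ := (hG.contDiffOn (s := Icc (-C) C)).exists_lipschitzOnWith one_ne_zero
    (convex_Icc _ _) isCompact_Icc
  refine squeeze_zero' (Eventually.of_forall fun E => Finset.sum_nonneg fun i _ => dist_nonneg)
    (g := fun E : ℕ × (ℕ → ℝ × ℝ) => K * ∑ i ∈ Finset.range E.1, dist (g (E.2 i).1) (g (E.2 i).2))
    ?_ (by simpa using Tendsto.const_mul (K : ℝ) hg)
  filter_upwards [mem_inf_of_right (mem_principal_self _)] with E hE
  rw [Finset.mul_sum]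
  refine Finset.sum_le_sum fun i hi => ?_
  exact hK.dist_le_mul _ (abs_le.1 (hC _ (hE.1 i hi).1)) _ (abs_le.1 (hC _ (hE.1 i hi).2))

theorem absolutelyContinuousOnInterval_sum {ι : Type*} (s : Finset ι) {g : ι → ℝ → ℝ} {a b : ℝ}
    (hg : ∀ i ∈ s, AbsolutelyContinuousOnInterval (g i) a b) :
    AbsolutelyContinuousOnInterval (fun t => ∑ i ∈ s, g i t) a b := by
  have h := Finset.sum_induction g (fun g => AbsolutelyContinuousOnInterval g a b)
    (fun _ _ h1 h2 => h1.add h2)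
    ((LipschitzWith.const (0 : ℝ)).lipschitzOnWith.absolutelyContinuousOnInterval) hg
  convert! h using 1
  ext t
  simp

theorem sub_le_of_ae_deriv_le {g : ℝ → ℝ} {a b t c : ℝ} (ha : 0 ≤ a) (hab : a ≤ b) (hbt : b ≤ t)
    (hg : AbsolutelyContinuousOnInterval g 0 t) (hc : ∀ᵐ u, u ∈ Ioo a b → deriv g u ≤ c) :
    g b - g a ≤ c * (b - a) := by
  have hg' : AbsolutelyContinuousOnInterval g a b := hg.mono (by
    rw [uIcc_of_le hab, uIcc_of_le (ha.trans (hab.trans hbt))]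
    exact Icc_subset_Icc ha hbt)
  rw [← hg'.integral_deriv_eq_sub]
  refine (intervalIntegral.integral_mono_ae_restrict hab hg'.intervalIntegrable_deriv
    (intervalIntegrable_const (c := c)) ?_).trans (by simp [mul_comm])
  rw [← restrict_Ioo_eq_restrict_Icc]
  exact (ae_restrict_iff' measurableSet_Ioo).2 hc

theorem zero_mem_horizon : (0 : ℝ) ∈ horizon T := ⟨le_rfl, by simp⟩

theorem mem_horizon_of_le {t u : ℝ} (ht : t ∈ horizon T) (hu : 0 ≤ u) (hut : u ≤ t) :
    u ∈ horizon T :=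
  ⟨hu, (ENNReal.ofReal_le_ofReal hut).trans ht.2⟩

theorem interior_of_lt {t u : ℝ} (ht : t ∈ horizon T) (hu : 0 < u) (hut : u < t) :
    0 < u ∧ ENNReal.ofReal u < T :=
  ⟨hu, ((ENNReal.ofReal_lt_ofReal_iff (hu.trans hut)).2 hut).trans_le ht.2⟩

theorem horizon_mem_nhds {u : ℝ} (hu : 0 < u ∧ ENNReal.ofReal u < T) : horizon T ∈ 𝓝 u := by
  filter_upwards [lt_mem_nhds hu.1,
    ENNReal.continuous_ofReal.continuousAt.eventually (gt_mem_nhds hu.2)] with v h1 h2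
  exact ⟨h1.le, h2.le⟩

theorem exists_pos_mem_horizon (hT : 0 < T) : ∃ t ∈ horizon T, 0 < t := by
  obtain ⟨r, hr0, hrT⟩ := ENNReal.lt_iff_exists_nnreal_btwn.1 hT
  refine ⟨r, ⟨r.2, ?_⟩, by exact_mod_cast hr0⟩
  rw [ENNReal.ofReal_coe_nnreal]
  exact hrT.le

namespace IsFluidSolution

variable {q a y : ℝ → Fin N → ℝ} {s : S → ℝ → ℝ}

theorem ae_isRegularTime (h : IsFluidSolution S lam f T q a y s) {t : ℝ} (ht : t ∈ horizon T) :
    ∀ᵐ u, u ∈ Ioo 0 t → IsRegularTime S T q a y s u := by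
  filter_upwards [ae_all_iff.2 fun n => (h.q_ac n t ht).ae_differentiableAt,
    ae_all_iff.2 fun n => (h.a_ac n t ht).ae_differentiableAt,
    ae_all_iff.2 fun n => (h.y_ac n t ht).ae_differentiableAt,
    ae_all_iff.2 fun π => (h.s_ac π t ht).ae_differentiableAt] with u h1 h2 h3 h4 hu
  have hmem : u ∈ uIcc 0 t := by
    rw [uIcc_of_le ht.1]
    exact Ioo_subset_Icc_self hu
  exact ⟨interior_of_lt ht hu.1 hu.2, fun n => h1 n hmem, fun n => h2 n hmem, fun n => h3 n hmem,
    fun π => h4 π hmem⟩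

theorem queue_apply (h : IsFluidSolution S lam f T q a y s) {t : ℝ} (ht : t ∈ horizon T)
    (n : Fin N) :
    q t n = q 0 n + t * lam n - ∑ π : S, s π t * (π : Fin N → ℝ) n + y t n := by
  have := congrFun (h.queue t ht) n
  rw [h.arrivals t ht] at this
  simpa [Finset.sum_apply] using this

theorem deriv_queue (h : IsFluidSolution S lam f T q a y s) {u : ℝ}
    (hu : IsRegularTime S T q a y s u) (n : Fin N) :
    deriv (fun v => q v n) u = lam n - ∑ π : S, deriv (s π) u * (π : Fin N → ℝ) n +
      deriv (fun v => y v n) u := by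
  have h1 : (fun v => q v n) =ᶠ[𝓝 u] fun v =>
      q 0 n + v * lam n - ∑ π : S, s π v * (π : Fin N → ℝ) n + y v n := by
    filter_upwards [horizon_mem_nhds hu.1] with v hv using h.queue_apply hv n
  rw [h1.deriv_eq]
  have h2 : HasDerivAt (fun v => ∑ π : S, s π v * (π : Fin N → ℝ) n)
      (∑ π : S, deriv (s π) u * (π : Fin N → ℝ) n) u :=
    HasDerivAt.fun_sum fun π _ => (hu.2.2.2.2 π).hasDerivAt.mul_const _
  have h3 : HasDerivAt (fun v => q 0 n + v * lam n) (lam n) u := by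
    simpa using ((hasDerivAt_id u).mul_const (lam n)).const_add (q 0 n)
  exact ((h3.sub h2).add (hu.2.2.2.1 n).hasDerivAt).deriv

theorem sum_deriv_service (h : IsFluidSolution S lam f T q a y s) {u : ℝ}
    (hu : IsRegularTime S T q a y s u) : ∑ π : S, deriv (s π) u = 1 := by
  have h1 : (fun v => ∑ π : S, s π v) =ᶠ[𝓝 u] id := by
    filter_upwards [horizon_mem_nhds hu.1] with v hv using h.busy v hv
  have h2 : HasDerivAt (fun v => ∑ π : S, s π v) (∑ π : S, deriv (s π) u) u :=
    HasDerivAt.fun_sum fun π _ => (hu.2.2.2.2 π).hasDerivAt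
  rw [← h2.deriv, h1.deriv_eq, deriv_id]

theorem deriv_service_nonneg (h : IsFluidSolution S lam f T q a y s) {u : ℝ}
    (hu : IsRegularTime S T q a y s u) (π : S) : 0 ≤ deriv (s π) u := by
  rw [← derivWithin_of_mem_nhds (horizon_mem_nhds hu.1)]
  exact (h.s_mono π).derivWithin_nonneg

/-- An empty queue is at a local minimum in time. This covers the times at which the idling rule is
silent. -/
theorem deriv_queue_of_eq_zero (h : IsFluidSolution S lam f T q a y s) {u : ℝ}
    (hu : IsRegularTime S T q a y s u) {n : Fin N} (hn : q u n = 0) :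
    deriv (fun v => q v n) u = 0 := by
  refine IsLocalMin.deriv_eq_zero ?_
  filter_upwards [horizon_mem_nhds hu.1] with v hv
  rw [hn]
  exact h.q_nonneg v hv n

theorem queue_le_of_arrival_eq_zero (h : IsFluidSolution S lam f T q a y s)
    (hS : ∀ π ∈ S, 0 ≤ π) {n : Fin N} (hn : lam n = 0) {t u : ℝ} (ht : t ∈ horizon T)
    (hu : u ∈ horizon T) (htu : t ≤ u) : q u n ≤ q t n := by
  have := sub_le_of_ae_deriv_le (c := 0) ht.1 htu le_rfl (h.q_ac n u hu) (by
    filter_upwards [h.ae_isRegularTime hu] with v hv hvI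
    have hreg := hv ⟨ht.1.trans_lt hvI.1, hvI.2⟩
    rcases (h.q_nonneg v (mem_horizon_of_le hu (ht.1.trans hvI.1.le) hvI.2.le) n).eq_or_lt
      with h0 | h0
    · exact (h.deriv_queue_of_eq_zero hreg h0.symm).le
    · rw [h.deriv_queue hreg, h.idling v hreg n h0, hn, zero_sub, add_zero, neg_nonpos]
      exact Finset.sum_nonneg fun π _ => mul_nonneg (h.deriv_service_nonneg hreg π) (hS π π.2 n))
  simpa using this

/-- Arrivals bring critical workload at rate exactly `1`, the schedules remove it at rate at most
`1`, and idling only returns some. -/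
theorem workload_le (h : IsFluidSolution S lam f T q a y s) {ξ : Fin N → ℝ}
    (hξ : ξ ∈ criticalResources S lam) {t u : ℝ} (ht : t ∈ horizon T)
    (hu : u ∈ horizon T) (htu : t ≤ u) : ξ ⬝ᵥ q t ≤ ξ ⬝ᵥ q u := by
  have hval : ∀ v ∈ horizon T, ξ ⬝ᵥ q v =
      ξ ⬝ᵥ q 0 + v - ∑ π : S, s π v * (ξ ⬝ᵥ (π : Fin N → ℝ)) + ξ ⬝ᵥ y v := fun v hv => by
    conv_lhs => rw [h.queue v hv, h.arrivals v hv]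
    rw [dotProduct_add, dotProduct_sub, dotProduct_add, dotProduct_smul, hξ.2, dotProduct_sum]
    simp [dotProduct_smul]
  have hy : ξ ⬝ᵥ y t ≤ ξ ⬝ᵥ y u :=
    dotProduct_mono_right (fun n => h.y_mono n ht hu htu) hξ.1.1.1.1
  have hs : ∑ π : S, (s π u - s π t) * (ξ ⬝ᵥ (π : Fin N → ℝ)) ≤ ∑ π : S, (s π u - s π t) :=
    Finset.sum_le_sum fun π _ => mul_le_of_le_one_right (sub_nonneg.2 (h.s_mono π ht hu htu))
      (hξ.1.1.1.2 π π.2)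
  simp only [sub_mul, Finset.sum_sub_distrib, h.busy u hu, h.busy t ht] at hs
  rw [hval t ht, hval u hu]
  linarith

/-- Combined with `liftFeasible_subset`, this makes the feasible sets shrink in time, so the optimal
value `L(Δ(q t))` is nondecreasing. -/
theorem mem_liftFeasible (h : IsFluidSolution S lam f T q a y s)
    (hS : ∀ π ∈ S, 0 ≤ π) {t u : ℝ} (ht : t ∈ horizon T)
    (hu : u ∈ horizon T) (htu : t ≤ u) : q u ∈ liftFeasible S lam (q t) :=
  ⟨h.q_nonneg u hu, fun _ hξ => h.workload_le hξ ht hu htu,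
    fun _ hn => h.queue_le_of_arrival_eq_zero hS hn ht hu htu⟩

/-- Idling drops out of the drift, since it occurs only at empty queues, whose weight is `f 0 = 0`.
The service rates sum to `1` and vanish on schedules lighter than `ρ`. -/
theorem deriv_sum_potential_le (h : IsFluidSolution S lam f T q a y s)
    (hf : WeightFunction S f) {u : ℝ}
    (hu : IsRegularTime S T q a y s u) {ρ : Fin N → ℝ} (hρ : ρ ∈ S) :
    deriv (fun v => ∑ n, potential f (q v n)) u ≤
      lam ⬝ᵥ weight f (q u) - ρ ⬝ᵥ weight f (q u) := by
  have huT : u ∈ horizon T := mem_of_mem_nhds (horizon_mem_nhds hu.1)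
  have hderiv : HasDerivAt (fun v => ∑ n, potential f (q v n))
      (∑ n, weight f (q u) n * deriv (fun v => q v n) u) u := by
    refine HasDerivAt.fun_sum fun n _ => ?_
    have := (hf.hasDerivAt_potential (q u n)).comp u (hu.2.1 n).hasDerivAt
    rwa [max_eq_left (show (0 : ℝ) ≤ q u n from h.q_nonneg u huT n)] at this
  have hterm : ∀ n, weight f (q u) n * deriv (fun v => q v n) u =
      lam n * weight f (q u) n - ∑ π : S, deriv (s π) u * ((π : Fin N → ℝ) n * weight f (q u) n) := by
    intro n
    have hy : weight f (q u) n * deriv (fun v => y v n) u = 0 := by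
      rcases (h.q_nonneg u huT n).eq_or_lt with h0 | h0
      · have : q u n = 0 := h0.symm
        simp [weight, this, hf.zero]
      · rw [h.idling u hu n h0, mul_zero]
    rw [h.deriv_queue hu, mul_add, hy, add_zero, mul_sub, Finset.mul_sum, mul_comm]
    congr 1
    exact Finset.sum_congr rfl fun π _ => by ring
  rw [hderiv.deriv, Finset.sum_congr rfl fun n _ => hterm n, Finset.sum_sub_distrib,
    Finset.sum_comm]
  simp only [← Finset.mul_sum]
  refine sub_le_sub_left ?_ _
  calc ρ ⬝ᵥ weight f (q u) = ∑ π : S, deriv (s π) u * (ρ ⬝ᵥ weight f (q u)) := by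
        rw [← Finset.sum_mul, h.sum_deriv_service hu, one_mul]
    _ ≤ ∑ π : S, deriv (s π) u * ((π : Fin N → ℝ) ⬝ᵥ weight f (q u)) := by
        refine Finset.sum_le_sum fun π _ => ?_
        rcases lt_or_ge ((π : Fin N → ℝ) ⬝ᵥ weight f (q u)) (ρ ⬝ᵥ weight f (q u)) with hlt | hge
        · rw [h.maxWeight u hu π ⟨ρ, hρ, hlt⟩, zero_mul, zero_mul]
        · exact mul_le_mul_of_nonneg_left hge (h.deriv_service_nonneg hu π)

/-- The Lyapunov function decreases at rate at least `η` while some schedule has weight exceeding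
that of the arrival rate by `η`. -/
theorem lyapunov_sub_le (h : IsFluidSolution S lam f T q a y s) (hf : WeightFunction S f)
    {t u η : ℝ} (ht : t ∈ horizon T) (hu : u ∈ horizon T) (htu : t ≤ u)
    (hη : ∀ v ∈ Ioo t u, ∃ ρ ∈ S, lam ⬝ᵥ weight f (q v) + η ≤ ρ ⬝ᵥ weight f (q v)) :
    lyapunov f (q u) - lyapunov f (q t) ≤ -η * (u - t) := by
  rw [lyapunov_eq (h.q_nonneg u hu), lyapunov_eq (h.q_nonneg t ht)]
  refine sub_le_of_ae_deriv_le (g := fun v => ∑ n, potential f (q v n)) ht.1 htu le_rfl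
    (absolutelyContinuousOnInterval_sum _ fun n _ =>
      absolutelyContinuousOnInterval_comp_of_contDiff hf.contDiff_potential (h.q_ac n u hu)) ?_
  filter_upwards [h.ae_isRegularTime hu] with v hv hvI
  obtain ⟨ρ, hρ, hle⟩ := hη v hvI
  have := h.deriv_sum_potential_le hf (hv ⟨ht.1.trans_lt hvI.1, hvI.2⟩) hρ
  linarith

end IsFluidSolution

theorem nonempty_of_mem_admissibleRegion (hlam : lam ∈ admissibleRegion S) : S.Nonempty := by
  obtain ⟨-, σ, hσ, -⟩ := hlam
  exact Finset.coe_nonempty.1 (convexHull_nonempty_iff.1 ⟨σ, hσ⟩)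

theorem exists_schedule_dotProduct_ge (hlam : lam ∈ admissibleRegion S) {u : Fin N → ℝ}
    (hu : 0 ≤ u) : ∃ ρ ∈ S, lam ⬝ᵥ u ≤ ρ ⬝ᵥ u := by
  obtain ⟨ρ, hρ, hmax⟩ := S.exists_max_image (fun π => π ⬝ᵥ u)
    (nonempty_of_mem_admissibleRegion hlam)
  exact ⟨ρ, hρ, dotProduct_le_of_forall_le hlam hu hmax⟩

namespace IsFluidSolution

variable {q a y : ℝ → Fin N → ℝ} {s : S → ℝ → ℝ}

theorem antitoneOn_lyapunov (h : IsFluidSolution S lam f T q a y s) (hf : WeightFunction S f)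
    (hlam : lam ∈ admissibleRegion S) :
    AntitoneOn (fun t => lyapunov f (q t)) (horizon T) := by
  intro t ht u hu htu
  have := h.lyapunov_sub_le hf (η := 0) ht hu htu fun v hv => by
    rw [add_zero]
    exact exists_schedule_dotProduct_ge hlam (hf.weight_nonneg
      (h.q_nonneg v (mem_horizon_of_le hu (ht.1.trans hv.1.le) hv.2.le)))
  simpa using this

/-- The later state is feasible for the problem at `q 0` and has no larger `L`, so it is a second
minimizer. -/
theorem eq_initial_of_eq_liftingMap (h : IsFluidSolution S lam f T q a y s)
    (hf : WeightFunction S f) (hS : ∀ π ∈ S, 0 ≤ π) (hlam : lam ∈ admissibleRegion S)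
    (h0 : q 0 = liftingMap S lam f (q 0)) {t : ℝ} (ht : t ∈ horizon T) : q t = q 0 := by
  have hq0 := h.q_nonneg 0 zero_mem_horizon
  have hopt := hf.isLiftOptimizer_liftingMap (lam := lam) hq0
  rw [← h0] at hopt
  refine hf.eq_of_isLiftOptimizer hopt ⟨h.mem_liftFeasible hS zero_mem_horizon ht ht.1, ?_⟩
  exact fun r hr => (h.antitoneOn_lyapunov hf hlam zero_mem_horizon ht ht.1).trans (hopt.2 r hr)

theorem isBalanced_of_stationary (h : IsFluidSolution S lam f T q a y s)
    (hf : WeightFunction S f) (hT : 0 < T) {q0 : Fin N → ℝ} (hq : ∀ t ∈ horizon T, q t = q0) :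
    IsBalanced S lam f q0 := by
  intro π hπ
  by_contra! hlt
  obtain ⟨t, ht, hpos⟩ := exists_pos_mem_horizon hT
  have := h.lyapunov_sub_le hf (η := π ⬝ᵥ weight f q0 - lam ⬝ᵥ weight f q0) zero_mem_horizon ht
    ht.1 fun v hv => ⟨π, hπ, by
      rw [hq v (mem_horizon_of_le ht hv.1.le hv.2.le)]
      linarith⟩
  rw [hq t ht, hq 0 zero_mem_horizon, sub_self, sub_zero] at this
  nlinarith [mul_pos (sub_pos.2 hlt) hpos]

end IsFluidSolution

/-- Fluid solutions that start in a compact set of states approach the invariant states uniformly. -/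
theorem exists_time_norm_sub_liftingMap_lt (hf : WeightFunction S f) (hS : ∀ π ∈ S, 0 ≤ π)
    (hserve : ∀ n, ∃ π ∈ S, 0 < π n) (hlam : lam ∈ admissibleRegion S) (B : ℝ) {ε : ℝ}
    (hε : 0 < ε) :
    ∃ H : ℝ, ∀ (T : ℝ≥0∞) (q a y : ℝ → Fin N → ℝ) (s : S → ℝ → ℝ),
      IsFluidSolution S lam f T q a y s → lyapunov f (q 0) ≤ B →
      ∀ t ∈ horizon T, H ≤ t → ‖q t - liftingMap S lam f (q t)‖ < ε := by
  set D : Set (Fin N → ℝ) := {q | 0 ≤ q ∧ lyapunov f q ≤ B}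
  have hD : IsCompact D := hf.isCompact_sublevel B
  have hDpos : D ⊆ {q | 0 ≤ q} := fun _ h => h.1
  have hΔ : ContinuousOn (liftingMap S lam f) D := hf.continuousOn_liftingMap.mono hDpos
  have hΔ0 : ∀ q, 0 ≤ q → 0 ≤ liftingMap S lam f q := fun q hq =>
    (hf.isLiftOptimizer_liftingMap hq).1.1
  let gap : (Fin N → ℝ) → ℝ := fun q => lyapunov f q - lyapunov f (liftingMap S lam f q)
  have hgap : ContinuousOn gap D := (hf.continuousOn_lyapunov.mono hDpos).sub
    (hf.continuousOn_lyapunov.comp hΔ fun q hq => hΔ0 q hq.1)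
  have hgap_pos : ∀ q, 0 ≤ q → q ≠ liftingMap S lam f q → 0 < gap q := fun q hq hne => by
    by_contra! hle
    refine hne (hf.eq_liftingMap ⟨self_mem_liftFeasible hq, fun r hr => ?_⟩ hq)
    exact (sub_nonpos.1 hle).trans ((hf.isLiftOptimizer_liftingMap hq).2 r hr)
  have hfar : IsCompact (D ∩ (fun q => ‖q - liftingMap S lam f q‖) ⁻¹' Ici ε) :=
    hD.of_isClosed_subset ((continuousOn_id.sub hΔ).norm.preimage_isClosed_of_isClosed
      hD.isClosed isClosed_Ici) inter_subset_left
  -- The gap is continuous and vanishes only at fixed points, so it is bounded below on the compact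
  -- set of states at distance at least `ε` from their lift.
  obtain ⟨δ, hδ, hδgap⟩ := hfar.exists_forall_le' (hgap.mono inter_subset_left) (a := 0)
    fun q hq => hgap_pos q hq.1.1 fun heq => by
      have h1 : ε ≤ ‖q - liftingMap S lam f q‖ := hq.2
      rw [← heq, sub_self, norm_zero] at h1
      linarith
  have hslow : IsCompact (D ∩ gap ⁻¹' Ici δ) :=
    hD.of_isClosed_subset (hgap.preimage_isClosed_of_isClosed hD.isClosed isClosed_Ici)
      inter_subset_left
  have hne := nonempty_of_mem_admissibleRegion hlam
  let excess : (Fin N → ℝ) → ℝ := fun q =>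
    S.sup' hne (fun ρ => ρ ⬝ᵥ weight f q) - lam ⬝ᵥ weight f q
  have hexcess : ContinuousOn excess D :=
    ((ContinuousOn.finset_sup'_apply hne fun ρ _ =>
      (continuous_dotProduct_right ρ).comp_continuousOn hf.continuousOn_weight).sub
      ((continuous_dotProduct_right lam).comp_continuousOn hf.continuousOn_weight)).mono hDpos
  -- Zero excess would mean balance, hence a fixed point and zero gap. On the compact set of states
  -- with gap at least `δ` the excess is thus bounded below.
  obtain ⟨η, hη, hηexcess⟩ := hslow.exists_forall_le' (hexcess.mono inter_subset_left) (a := 0)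
    fun q hq => by
      by_contra! hle
      have hbal : IsBalanced S lam f q := fun π hπ =>
        (Finset.le_sup' (fun ρ => ρ ⬝ᵥ weight f q) hπ).trans (sub_nonpos.1 hle)
      have heq := (hf.eq_liftingMap_self_iff hS hserve hlam hq.1.1).2 hbal
      have h1 : δ ≤ gap q := hq.2
      simp only [gap, ← heq, sub_self] at h1
      linarith
  -- If the state were still far at time `t`, the gap would be at least `δ` at all earlier times, so
  -- `L` would have decreased at rate `η` throughout. By time `B / η + 1` it would be at most `-η`,
  -- yet `L ≥ 0`.
  refine ⟨B / η + 1, fun T q a y s h hB t ht hHt => ?_⟩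
  have hqD : ∀ v ∈ horizon T, q v ∈ D := fun v hv =>
    ⟨h.q_nonneg v hv, (h.antitoneOn_lyapunov hf hlam zero_mem_horizon hv hv.1).trans hB⟩
  by_contra! hge
  have hgapt : δ ≤ gap (q t) := hδgap _ ⟨hqD t ht, hge⟩
  have hrate := h.lyapunov_sub_le hf (η := η) zero_mem_horizon ht ht.1 fun v hv => by
    have hvT := mem_horizon_of_le ht hv.1.le hv.2.le
    have h1 : lyapunov f (q t) ≤ lyapunov f (q v) := h.antitoneOn_lyapunov hf hlam hvT ht hv.2.le
    have h2 : lyapunov f (liftingMap S lam f (q v)) ≤ lyapunov f (liftingMap S lam f (q t)) :=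
      (hf.isLiftOptimizer_liftingMap (h.q_nonneg v hvT)).2 _
        (liftFeasible_subset (h.mem_liftFeasible hS hvT ht hv.2.le)
          (hf.isLiftOptimizer_liftingMap (h.q_nonneg t ht)).1)
    have h3 : δ ≤ gap (q v) := by
      simp only [gap] at hgapt ⊢
      linarith
    have h4 := hηexcess _ ⟨hqD v hvT, h3⟩
    obtain ⟨ρ, hρ, hsup⟩ := S.exists_mem_eq_sup' hne (fun ρ => ρ ⬝ᵥ weight f (q v))
    refine ⟨ρ, hρ, ?_⟩
    simp only [excess, hsup] at h4
    linarith
  have hL := hf.lyapunov_nonneg (h.q_nonneg t ht)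
  have h5 : B / η * η = B := div_mul_cancel₀ B hη.ne'
  nlinarith

end

/-! ### Existence of fluid solutions by an Euler scheme. -/

section

variable {N : ℕ} {S : Finset (Fin N → ℝ)} {f : ℝ → ℝ} {lam : Fin N → ℝ}

/-- The number of time steps of length `1 / (m + 1)` completed by time `t`. -/
def stepCount (m : ℕ) (t : ℝ) : ℕ := ⌊t * (m + 1)⌋₊

theorem stepCount_zero (m : ℕ) : stepCount m 0 = 0 := by simp [stepCount]

theorem stepCount_mono (m : ℕ) {t u : ℝ} (htu : t ≤ u) : stepCount m t ≤ stepCount m u :=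
  Nat.floor_mono (by gcongr)

theorem stepCount_div_le (m : ℕ) {t : ℝ} (ht : 0 ≤ t) : (stepCount m t : ℝ) / (m + 1) ≤ t := by
  rw [div_le_iff₀ (by positivity)]
  exact Nat.floor_le (by positivity)

theorem lt_stepCount_div_add (m : ℕ) (t : ℝ) :
    t < (stepCount m t : ℝ) / (m + 1) + 1 / (m + 1) := by
  rw [← add_div, lt_div_iff₀ (by positivity)]
  exact Nat.lt_floor_add_one _

theorem tendsto_inv_add_one_hyperfilter :
    Tendsto (fun m : ℕ => 1 / ((m : ℝ) + 1)) (hyperfilter ℕ) (𝓝 0) :=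
  tendsto_one_div_add_atTop_nhds_zero_nat.mono_left Nat.hyperfilter_le_atTop

theorem tendsto_stepCount_div {t : ℝ} (ht : 0 ≤ t) :
    Tendsto (fun m : ℕ => (stepCount m t : ℝ) / (m + 1)) (hyperfilter ℕ) (𝓝 t) := by
  have h := tendsto_const_nhds (x := t).sub tendsto_inv_add_one_hyperfilter
  rw [sub_zero] at h
  refine tendsto_of_tendsto_of_tendsto_of_le_of_le h tendsto_const_nhds (fun m => ?_)
    fun m => stepCount_div_le m ht
  have := lt_stepCount_div_add m t
  show t - 1 / ((m : ℝ) + 1) ≤ _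
  linarith

/-- The cumulative process at time `t` of the rates `g m j` over steps of length `1 / (m + 1)`. -/
def cumulative (g : ℕ → ℕ → ℝ) (m : ℕ) (t : ℝ) : ℝ :=
  ∑ j ∈ Finset.range (stepCount m t), g m j / (m + 1)

/-- The limit along an ultrafilter of the cumulative processes. -/
def limitProcess (g : ℕ → ℕ → ℝ) (t : ℝ) : ℝ :=
  limUnder (hyperfilter ℕ : Filter ℕ) fun m => cumulative g m t

section LimitProcess

variable {g : ℕ → ℕ → ℝ} {C : ℝ}

theorem cumulative_sub (g : ℕ → ℕ → ℝ) (m : ℕ) {t u : ℝ} (htu : t ≤ u) :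
    cumulative g m u - cumulative g m t =
      ∑ j ∈ Finset.Ico (stepCount m t) (stepCount m u), g m j / (m + 1) :=
  (Finset.sum_Ico_eq_sub _ (stepCount_mono m htu)).symm

theorem cumulative_mono (hg0 : ∀ m j, 0 ≤ g m j) (m : ℕ) {t u : ℝ} (htu : t ≤ u) :
    cumulative g m t ≤ cumulative g m u := by
  rw [← sub_nonneg, cumulative_sub g m htu]
  exact Finset.sum_nonneg fun j _ => div_nonneg (hg0 m j) (by positivity)

/-- The extra `1 / (m + 1)` pays for rounding times to the grid; it disappears in the limit, leaving
a Lipschitz bound. -/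
theorem cumulative_sub_le (hg0 : ∀ m j, 0 ≤ g m j) (hgC : ∀ m j, g m j ≤ C) (m : ℕ) {t u : ℝ}
    (ht : 0 ≤ t) (htu : t ≤ u) :
    cumulative g m u - cumulative g m t ≤ C * (u - t + 1 / (m + 1)) := by
  have hC : 0 ≤ C := (hg0 0 0).trans (hgC 0 0)
  rw [cumulative_sub g m htu]
  calc ∑ j ∈ Finset.Ico (stepCount m t) (stepCount m u), g m j / (m + 1)
      ≤ ∑ j ∈ Finset.Ico (stepCount m t) (stepCount m u), C / (m + 1) :=
        Finset.sum_le_sum fun j _ => by gcongr; exact hgC m j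
    _ = C * ((stepCount m u : ℝ) / (m + 1) - (stepCount m t : ℝ) / (m + 1)) := by
        rw [Finset.sum_const, Nat.card_Ico, nsmul_eq_mul, Nat.cast_sub (stepCount_mono m htu)]
        ring
    _ ≤ C * (u - t + 1 / (m + 1)) := by
        have h1 := stepCount_div_le m (ht.trans htu)
        have h2 := lt_stepCount_div_add m t
        exact mul_le_mul_of_nonneg_left (by linarith) hC

theorem cumulative_zero (g : ℕ → ℕ → ℝ) (m : ℕ) : cumulative g m 0 = 0 := by
  simp [cumulative, stepCount_zero]

/-- At each time the cumulative values lie in a compact interval, so the ultrafilter limit exists.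
One ultrafilter serves all times and all components, without extracting subsequences. -/
theorem tendsto_limitProcess (hg0 : ∀ m j, 0 ≤ g m j) (hgC : ∀ m j, g m j ≤ C) {t : ℝ}
    (ht : 0 ≤ t) :
    Tendsto (fun m => cumulative g m t) (hyperfilter ℕ) (𝓝 (limitProcess g t)) := by
  have hC : 0 ≤ C := (hg0 0 0).trans (hgC 0 0)
  have hmem : ∀ m, cumulative g m t ∈ Icc 0 (C * (t + 1)) := fun m => by
    have h1 := cumulative_mono hg0 m ht
    have h2 := cumulative_sub_le hg0 hgC m le_rfl ht
    rw [cumulative_zero] at h1 h2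
    refine ⟨h1, (sub_zero (cumulative g m t) ▸ h2).trans (mul_le_mul_of_nonneg_left ?_ hC)⟩
    have : 1 / ((m : ℝ) + 1) ≤ 1 := by
      rw [div_le_one (by positivity)]
      linarith [(Nat.cast_nonneg m : (0 : ℝ) ≤ m)]
    linarith
  obtain ⟨x, -, hx⟩ := isCompact_Icc.ultrafilter_le_nhds
    ((hyperfilter ℕ).map fun m => cumulative g m t)
    (tendsto_principal.2 (Eventually.of_forall hmem))
  exact tendsto_nhds_limUnder ⟨x, hx⟩

theorem limitProcess_mono (hg0 : ∀ m j, 0 ≤ g m j) (hgC : ∀ m j, g m j ≤ C) {t u : ℝ}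
    (ht : 0 ≤ t) (htu : t ≤ u) : limitProcess g t ≤ limitProcess g u :=
  le_of_tendsto_of_tendsto' (tendsto_limitProcess hg0 hgC ht)
    (tendsto_limitProcess hg0 hgC (ht.trans htu)) fun m => cumulative_mono hg0 m htu

theorem limitProcess_zero (g : ℕ → ℕ → ℝ) : limitProcess g 0 = 0 := by
  have : (fun m => cumulative g m 0) = fun _ => 0 := funext fun m => cumulative_zero g m
  rw [limitProcess, this]
  exact tendsto_const_nhds.limUnder_eq

theorem limitProcess_nonneg (hg0 : ∀ m j, 0 ≤ g m j) (hgC : ∀ m j, g m j ≤ C) {t : ℝ}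
    (ht : 0 ≤ t) : 0 ≤ limitProcess g t := by
  rw [← limitProcess_zero g]
  exact limitProcess_mono hg0 hgC le_rfl ht

theorem limitProcess_sub_le (hg0 : ∀ m j, 0 ≤ g m j) (hgC : ∀ m j, g m j ≤ C) {t u : ℝ}
    (ht : 0 ≤ t) (htu : t ≤ u) : limitProcess g u - limitProcess g t ≤ C * (u - t) := by
  have h := (tendsto_inv_add_one_hyperfilter.const_add (u - t)).const_mul C
  rw [add_zero] at h
  exact le_of_tendsto_of_tendsto' ((tendsto_limitProcess hg0 hgC (ht.trans htu)).sub
    (tendsto_limitProcess hg0 hgC ht)) h fun m => cumulative_sub_le hg0 hgC m ht htu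

theorem absolutelyContinuousOnInterval_limitProcess (hg0 : ∀ m j, 0 ≤ g m j)
    (hgC : ∀ m j, g m j ≤ C) {t : ℝ} (ht : 0 ≤ t) :
    AbsolutelyContinuousOnInterval (limitProcess g) 0 t := by
  have hC : 0 ≤ C := (hg0 0 0).trans (hgC 0 0)
  refine LipschitzOnWith.absolutelyContinuousOnInterval (K := ⟨C, hC⟩)
    (LipschitzOnWith.of_le_add_mul _ fun u hu v hv => ?_)
  rw [uIcc_of_le ht] at hu hv
  show limitProcess g u ≤ limitProcess g v + C * dist u v
  rcases le_total u v with h | h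
  · have := limitProcess_mono hg0 hgC hu.1 h
    have : 0 ≤ C * dist u v := by positivity
    linarith
  · have := limitProcess_sub_le hg0 hgC hv.1 h
    rw [Real.dist_eq, abs_of_nonneg (sub_nonneg.2 h)]
    linarith

/-- This transfers the idling and max-weight rules to the limit: if the discrete rates vanish
throughout a time window around `t`, the limit is locally constant. -/
theorem deriv_limitProcess_eq_zero (hg0 : ∀ m j, 0 ≤ g m j) (hgC : ∀ m j, g m j ≤ C) {t δ : ℝ}
    (ht : 0 < t) (hδ : 0 < δ)
    (h : ∀ᶠ m in (hyperfilter ℕ : Filter ℕ), ∀ u v : ℝ, 0 ≤ u → t - δ ≤ u → v ≤ t + δ →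
      ∀ j ∈ Finset.Ico (stepCount m u) (stepCount m v), g m j = 0) :
    deriv (limitProcess g) t = 0 := by
  have hconst : ∀ u v : ℝ, 0 ≤ u → t - δ ≤ u → v ≤ t + δ → u ≤ v →
      limitProcess g v = limitProcess g u := fun u v hu hut hvt huv => by
    refine tendsto_nhds_unique (tendsto_limitProcess hg0 hgC (hu.trans huv))
      ((tendsto_limitProcess hg0 hgC hu).congr' ?_)
    filter_upwards [h] with m hm
    rw [eq_comm, ← sub_eq_zero, cumulative_sub g m huv]
    exact Finset.sum_eq_zero fun j hj => by rw [hm u v hu hut hvt j hj, zero_div]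
  have hev : limitProcess g =ᶠ[𝓝 t] fun _ => limitProcess g t := by
    filter_upwards [lt_mem_nhds ht, lt_mem_nhds (sub_lt_self t hδ),
      gt_mem_nhds (lt_add_of_pos_right t hδ)] with u h0 h1 h2
    rcases le_total u t with hut | hut
    · exact (hconst u t h0.le h1.le (by linarith) hut).symm
    · exact hconst t u ht.le (by linarith) h2.le hut
  rw [hev.deriv_eq, deriv_const]

end LimitProcess

/-- The Euler scheme with step `h` for the queue lengths, under the scheduling rule `sched`. -/
def eulerState (sched : (Fin N → ℝ) → S) (lam q0 : Fin N → ℝ) (h : ℝ) : ℕ → Fin N → ℝ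
  | 0 => q0
  | k + 1 => fun n => max (eulerState sched lam q0 h k n +
      h * (lam n - (sched (eulerState sched lam q0 h k) : Fin N → ℝ) n)) 0

/-- The rate at which offered service is wasted at queue `n` in step `j` of the Euler scheme. -/
def eulerIdle (sched : (Fin N → ℝ) → S) (lam q0 : Fin N → ℝ) (h : ℝ) (n : Fin N) (j : ℕ) : ℝ :=
  max ((sched (eulerState sched lam q0 h j) : Fin N → ℝ) n - lam n -
    eulerState sched lam q0 h j n / h) 0

open Classical in
/-- The indicator that the Euler scheme uses schedule `π` in step `j`. -/
def eulerService (sched : (Fin N → ℝ) → S) (lam q0 : Fin N → ℝ) (h : ℝ) (π : S) (j : ℕ) : ℝ :=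
  if sched (eulerState sched lam q0 h j) = π then 1 else 0

section Euler

variable {sched : (Fin N → ℝ) → S} {q0 : Fin N → ℝ} {h C : ℝ}

theorem eulerState_nonneg (hq0 : 0 ≤ q0) (k : ℕ) : 0 ≤ eulerState sched lam q0 h k := by
  cases k with
  | zero => exact hq0
  | succ k => exact fun n => le_max_right _ _

theorem eulerIdle_nonneg (n : Fin N) (j : ℕ) : 0 ≤ eulerIdle sched lam q0 h n j :=
  le_max_right _ _

theorem eulerIdle_le (hS : ∀ π ∈ S, 0 ≤ π) (hlam : 0 ≤ lam) (hq0 : 0 ≤ q0) (hh : 0 < h)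
    (n : Fin N) (j : ℕ) :
    eulerIdle sched lam q0 h n j ≤ (sched (eulerState sched lam q0 h j) : Fin N → ℝ) n := by
  refine max_le ?_ (hS _ (sched _).2 n)
  have h1 := hlam n
  have h2 : 0 ≤ eulerState sched lam q0 h j n / h := div_nonneg (eulerState_nonneg hq0 j n) hh.le
  simp only [Pi.zero_apply] at h1
  linarith

theorem eulerService_nonneg (π : S) (j : ℕ) : 0 ≤ eulerService sched lam q0 h π j := by
  unfold eulerService
  split_ifs <;> norm_num

theorem eulerService_le_one (π : S) (j : ℕ) : eulerService sched lam q0 h π j ≤ 1 := by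
  unfold eulerService
  split_ifs <;> norm_num

theorem sum_eulerService (j : ℕ) : ∑ π : S, eulerService sched lam q0 h π j = 1 := by
  simp [eulerService]

theorem sum_eulerService_mul (j : ℕ) (n : Fin N) :
    ∑ π : S, eulerService sched lam q0 h π j * (π : Fin N → ℝ) n =
      (sched (eulerState sched lam q0 h j) : Fin N → ℝ) n := by
  simp [eulerService, ite_mul]

theorem eulerState_eq (hh : 0 < h) (k : ℕ) (n : Fin N) :
    eulerState sched lam q0 h k n = q0 n + k * h * lam n -
      ∑ π : S, (∑ j ∈ Finset.range k, eulerService sched lam q0 h π j * h) * (π : Fin N → ℝ) n +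
      ∑ j ∈ Finset.range k, eulerIdle sched lam q0 h n j * h := by
  induction k with
  | zero => simp [eulerState]
  | succ k ih =>
    have h1 : eulerState sched lam q0 h (k + 1) n = eulerState sched lam q0 h k n +
        h * (lam n - (sched (eulerState sched lam q0 h k) : Fin N → ℝ) n) +
        eulerIdle sched lam q0 h n k * h := by
      have h2 : eulerState sched lam q0 h k n / h * h = eulerState sched lam q0 h k n :=
        div_mul_cancel₀ _ hh.ne'
      -- The truncation at zero is read as wasted service, through `max x 0 = x + max (-x) 0`.
      rw [eulerIdle, max_mul_of_nonneg _ _ hh.le, zero_mul, ← max_add_add_left]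
      simp only [eulerState, sub_mul, h2]
      rw [max_comm]
      congr 1 <;> ring
    have h3 : ∑ π : S, (∑ j ∈ Finset.range (k + 1), eulerService sched lam q0 h π j * h) *
        (π : Fin N → ℝ) n =
        ∑ π : S, (∑ j ∈ Finset.range k, eulerService sched lam q0 h π j * h) * (π : Fin N → ℝ) n +
        h * (sched (eulerState sched lam q0 h k) : Fin N → ℝ) n := by
      rw [← sum_eulerService_mul, Finset.mul_sum, ← Finset.sum_add_distrib]
      refine Finset.sum_congr rfl fun π _ => ?_
      rw [Finset.sum_range_succ]
      ring
    rw [h1, h3, Finset.sum_range_succ, ih]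
    push_cast
    ring

theorem abs_eulerState_succ_sub_le (hS : ∀ π ∈ S, 0 ≤ π) (hlam : 0 ≤ lam) (hq0 : 0 ≤ q0)
    (hh : 0 < h) (hCS : ∀ π ∈ S, ∀ n, π n ≤ C) (hClam : ∀ n, lam n ≤ C) (k : ℕ) (n : Fin N) :
    |eulerState sched lam q0 h (k + 1) n - eulerState sched lam q0 h k n| ≤ C * h := by
  have h1 : (0 : ℝ) ≤ eulerState sched lam q0 h k n := eulerState_nonneg hq0 k n
  have h2 := hCS _ (sched (eulerState sched lam q0 h k)).2 n
  have h3 : (0 : ℝ) ≤ (sched (eulerState sched lam q0 h k) : Fin N → ℝ) n :=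
    hS _ (sched (eulerState sched lam q0 h k)).2 n
  have h4 := hClam n
  have h5 : (0 : ℝ) ≤ lam n := hlam n
  simp only [eulerState]
  set x := eulerState sched lam q0 h k n
  set d := lam n - (sched (eulerState sched lam q0 h k) : Fin N → ℝ) n
  have hd1 : d ≤ C := by simp only [d]; linarith
  have hd2 : -C ≤ d := by simp only [d]; linarith
  have h6 : h * d ≤ C * h := by nlinarith
  have h7 : -(C * h) ≤ h * d := by nlinarith
  have h8 : 0 ≤ C * h := mul_nonneg (h5.trans h4) hh.le
  rw [abs_le]
  constructor
  · have := le_max_left (x + h * d) 0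
    linarith
  · have : max (x + h * d) 0 ≤ x + C * h := max_le (by linarith) (by linarith)
    linarith

theorem abs_eulerState_sub_le (hS : ∀ π ∈ S, 0 ≤ π) (hlam : 0 ≤ lam) (hq0 : 0 ≤ q0)
    (hh : 0 < h) (hCS : ∀ π ∈ S, ∀ n, π n ≤ C) (hClam : ∀ n, lam n ≤ C) (j k : ℕ) (n : Fin N) :
    |eulerState sched lam q0 h j n - eulerState sched lam q0 h k n| ≤ C * |j * h - k * h| := by
  wlog hjk : k ≤ j generalizing j k
  · rw [abs_sub_comm, abs_sub_comm (j * h)]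
    exact this k j (le_of_not_ge hjk)
  have hC : 0 ≤ C := le_trans (hlam n) (hClam n)
  have hle : (k : ℝ) ≤ j := by exact_mod_cast hjk
  rw [← sub_mul, abs_of_nonneg (mul_nonneg (sub_nonneg.2 hle) hh.le)]
  induction j, hjk using Nat.le_induction with
  | base => simp
  | succ j hj ih =>
    have h1 := ih (by exact_mod_cast hj)
    have h2 := abs_eulerState_succ_sub_le (sched := sched) hS hlam hq0 hh hCS hClam j n
    have h3 := abs_sub_le (eulerState sched lam q0 h (j + 1) n) (eulerState sched lam q0 h j n)
      (eulerState sched lam q0 h k n)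
    push_cast
    linarith

end Euler

/-- A fluid model solution exists from every initial state. -/
theorem exists_isFluidSolution (hf : WeightFunction S f) (hS : ∀ π ∈ S, 0 ≤ π)
    (hne : S.Nonempty) (hlam : 0 ≤ lam) {q0 : Fin N → ℝ} (hq0 : 0 ≤ q0) :
    ∃ (q a y : ℝ → Fin N → ℝ) (s : S → ℝ → ℝ),
      (∀ T, IsFluidSolution S lam f T q a y s) ∧ q 0 = q0 := by
  have hmax : ∀ q : Fin N → ℝ, ∃ π : S, IsMaxWeight S f q π := fun q => by
    obtain ⟨π, hπ, h⟩ := S.exists_max_image (fun π => π ⬝ᵥ weight f q) hne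
    exact ⟨⟨π, hπ⟩, hπ, h⟩
  choose sched hsched using hmax
  obtain ⟨C, hC1, hCS, hClam⟩ :
      ∃ C : ℝ, 1 ≤ C ∧ (∀ π ∈ S, ∀ n, π n ≤ C) ∧ ∀ n, lam n ≤ C := by
    have hπ : ∀ π ∈ S, ∀ n, 0 ≤ π n := fun π h n => hS π h n
    have hl : ∀ n, 0 ≤ lam n := fun n => hlam n
    have h1 : 0 ≤ ∑ π ∈ S, ∑ n, π n :=
      Finset.sum_nonneg fun π h => Finset.sum_nonneg fun n _ => hπ π h n
    have h2 : 0 ≤ ∑ n, lam n := Finset.sum_nonneg fun n _ => hl n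
    refine ⟨1 + ∑ π ∈ S, ∑ n, π n + ∑ n, lam n, by linarith, fun π h n => ?_, fun n => ?_⟩
    · have h3 := Finset.single_le_sum (f := fun π : Fin N → ℝ => ∑ n, π n)
        (fun π h => Finset.sum_nonneg fun n _ => hπ π h n) h
      have h4 := Finset.single_le_sum (f := fun n => π n) (fun n _ => hπ π h n) (Finset.mem_univ n)
      linarith
    · have h4 := Finset.single_le_sum (f := fun n => lam n) (fun n _ => hl n) (Finset.mem_univ n)
      linarith
  have hC0 : 0 < C := by linarith
  let step : ℕ → ℝ := fun m => 1 / ((m : ℝ) + 1)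
  have hstep : ∀ m, 0 < step m := fun m => by positivity
  let Q : ℕ → ℕ → Fin N → ℝ := fun m => eulerState sched lam q0 (step m)
  let gy : Fin N → ℕ → ℕ → ℝ := fun n m => eulerIdle sched lam q0 (step m) n
  let gs : S → ℕ → ℕ → ℝ := fun π m => eulerService sched lam q0 (step m) π
  have hgy0 : ∀ n m j, 0 ≤ gy n m j := fun n m j => eulerIdle_nonneg n j
  have hgyS : ∀ n m j, gy n m j ≤ (sched (Q m j) : Fin N → ℝ) n := fun n m j =>
    eulerIdle_le hS hlam hq0 (hstep m) n j
  have hgyC : ∀ n m j, gy n m j ≤ C := fun n m j => (hgyS n m j).trans (hCS _ (sched _).2 n)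
  have hgs0 : ∀ π m j, 0 ≤ gs π m j := fun π m j => eulerService_nonneg π j
  have hgs1 : ∀ π m j, gs π m j ≤ 1 := fun π m j => eulerService_le_one π j
  let y : ℝ → Fin N → ℝ := fun t n => limitProcess (gy n) t
  let s : S → ℝ → ℝ := fun π => limitProcess (gs π)
  let a : ℝ → Fin N → ℝ := fun t => t • lam
  let q : ℝ → Fin N → ℝ := fun t => q0 + a t - ∑ π : S, s π t • (π : Fin N → ℝ) + y t
  have hq_apply : ∀ t n, q t n = q0 n + t * lam n - ∑ π : S, s π t * (π : Fin N → ℝ) n + y t n :=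
    fun t n => by simp [q, a, Finset.sum_apply]
  have hqz : q 0 = q0 := by
    ext n
    simp [hq_apply, s, y, limitProcess_zero]
  have hs_lim : ∀ π, ∀ t, 0 ≤ t → Tendsto (fun m => cumulative (gs π) m t) (hyperfilter ℕ)
      (𝓝 (s π t)) := fun π t ht => tendsto_limitProcess (hgs0 π) (hgs1 π) ht
  have hy_lim : ∀ n, ∀ t, 0 ≤ t → Tendsto (fun m => cumulative (gy n) m t) (hyperfilter ℕ)
      (𝓝 (y t n)) := fun n t ht => tendsto_limitProcess (hgy0 n) (hgyC n) ht
  have hoffered_lim : ∀ n, ∀ t, 0 ≤ t → Tendsto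
      (fun m => ∑ π : S, cumulative (gs π) m t * (π : Fin N → ℝ) n) (hyperfilter ℕ)
      (𝓝 (∑ π : S, s π t * (π : Fin N → ℝ) n)) := fun n t ht =>
    tendsto_finsetSum _ fun π _ => (hs_lim π t ht).mul_const _
  have hq_lim : ∀ n, ∀ t, 0 ≤ t → Tendsto (fun m => Q m (stepCount m t) n) (hyperfilter ℕ)
      (𝓝 (q t n)) := fun n t ht => by
    rw [hq_apply]
    refine ((((tendsto_stepCount_div ht).mul_const (lam n)).const_add (q0 n)).sub
      (hoffered_lim n t ht)).add (hy_lim n t ht) |>.congr fun m => ?_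
    simp only [Q, eulerState_eq (hstep m), cumulative, gs, gy, step, mul_one_div]
  have hQ0 : ∀ m k n, 0 ≤ Q m k n := fun m k n => eulerState_nonneg hq0 k n
  have hq_nonneg : ∀ t, 0 ≤ t → 0 ≤ q t := fun t ht n =>
    ge_of_tendsto' (hq_lim n t ht) fun m => hQ0 m _ n
  have hbusy : ∀ t, 0 ≤ t → ∑ π : S, s π t = t := fun t ht => by
    refine tendsto_nhds_unique (tendsto_finsetSum _ fun π _ => hs_lim π t ht)
      ((tendsto_stepCount_div ht).congr fun m => ?_)
    simp only [cumulative]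
    rw [Finset.sum_comm]
    simp only [← Finset.sum_div, gs, sum_eulerService]
    simp [Finset.sum_const, div_eq_mul_inv]
  have hlittle : ∀ t, 0 ≤ t → y t ≤ ∑ π : S, s π t • (π : Fin N → ℝ) := fun t ht n => by
    have h1 : y t n ≤ ∑ π : S, s π t * (π : Fin N → ℝ) n := by
      refine le_of_tendsto_of_tendsto' (hy_lim n t ht) (hoffered_lim n t ht) fun m => ?_
      simp only [cumulative, Finset.sum_mul]
      rw [Finset.sum_comm]
      refine Finset.sum_le_sum fun j _ => ?_
      rw [← Finset.sum_congr rfl fun (π : S) _ => (div_mul_eq_mul_div _ _ _).symm,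
        ← Finset.sum_div]
      refine div_le_div_of_nonneg_right ?_ (by positivity)
      exact (hgyS n m j).trans (sum_eulerService_mul j n).symm.le
    simpa [Finset.sum_apply] using h1
  have hnear : ∀ t, 0 ≤ t → ∀ r, 0 < r → ∃ δ > 0, ∀ᶠ m in (hyperfilter ℕ : Filter ℕ),
      ∀ u v : ℝ, 0 ≤ u → t - δ ≤ u → v ≤ t + δ →
      ∀ j ∈ Finset.Ico (stepCount m u) (stepCount m v), ∀ n, |Q m j n - q t n| < r := by
    intro t ht r hr
    -- The Euler states move at speed at most `C`. Window and step each contribute at most `r / 4`,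
    -- and the remaining `r / 2` is the error at time `t` itself.
    refine ⟨r / (4 * C), by positivity, ?_⟩
    have h1 : ∀ᶠ m in (hyperfilter ℕ : Filter ℕ), ∀ n,
        |Q m (stepCount m t) n - q t n| < r / 2 := eventually_all.2 fun n =>
      (Metric.tendsto_nhds.1 (hq_lim n t ht) (r / 2) (half_pos hr)).mono fun m hm => by
        rwa [Real.dist_eq] at hm
    have h2 : ∀ᶠ m in (hyperfilter ℕ : Filter ℕ), step m < r / (4 * C) :=
      tendsto_inv_add_one_hyperfilter.eventually (gt_mem_nhds (by positivity))
    filter_upwards [h1, h2] with m h1 h2 u v hu hut hvt j hj n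
    rw [Finset.mem_Ico] at hj
    have hv : 0 ≤ v := by
      by_contra! hneg
      have : stepCount m v = 0 := Nat.floor_of_nonpos
        (mul_nonpos_of_nonpos_of_nonneg hneg.le (by positivity))
      omega
    have h3 : (stepCount m u : ℝ) / (m + 1) ≤ (j : ℝ) / (m + 1) := by
      gcongr
      exact hj.1
    have h4 : (j : ℝ) / (m + 1) ≤ (stepCount m v : ℝ) / (m + 1) := by
      gcongr
      exact hj.2.le
    have h5 := lt_stepCount_div_add m u
    have h6 := stepCount_div_le m hv
    have h7 := lt_stepCount_div_add m t
    have h8 := stepCount_div_le m ht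
    have h9 : |(j : ℝ) * step m - stepCount m t * step m| ≤ r / (4 * C) + step m := by
      rw [abs_le]
      simp only [step, mul_one_div]
      constructor <;> linarith
    have h10 : |Q m j n - Q m (stepCount m t) n| ≤ C * (r / (4 * C) + step m) :=
      (abs_eulerState_sub_le hS hlam hq0 (hstep m) hCS hClam j (stepCount m t) n).trans
        (mul_le_mul_of_nonneg_left h9 hC0.le)
    have h11 : C * (r / (4 * C) + step m) < r / 2 := by
      calc C * (r / (4 * C) + step m) < C * (r / (4 * C) + r / (4 * C)) := by gcongr
        _ = r / 2 := by field_simp; norm_num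
    have h12 := abs_sub_le (Q m j n) (Q m (stepCount m t) n) (q t n)
    linarith [h1 n]
  have hs_ac : ∀ π t, 0 ≤ t → AbsolutelyContinuousOnInterval (s π) 0 t := fun π t ht =>
    absolutelyContinuousOnInterval_limitProcess (hgs0 π) (hgs1 π) ht
  have hy_ac : ∀ n t, 0 ≤ t → AbsolutelyContinuousOnInterval (fun u => y u n) 0 t := fun n t ht =>
    absolutelyContinuousOnInterval_limitProcess (hgy0 n) (hgyC n) ht
  have ha_ac : ∀ n t, AbsolutelyContinuousOnInterval (fun u => a u n) 0 t := fun n t =>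
    ContDiffOn.absolutelyContinuousOnInterval (by
      have : ContDiff ℝ 1 fun u : ℝ => u * lam n := by fun_prop
      exact this.contDiffOn)
  refine ⟨q, a, y, s, fun T => ?_, hqz⟩
  refine
    { q_nonneg := fun t ht => hq_nonneg t ht.1
      a_nonneg := fun t ht => smul_nonneg ht.1 hlam
      y_nonneg := fun t ht n => limitProcess_nonneg (hgy0 n) (hgyC n) ht.1
      s_nonneg := fun π t ht => limitProcess_nonneg (hgs0 π) (hgs1 π) ht.1
      queue := fun t ht => by rw [hqz]
      arrivals := fun t ht => rfl
      busy := fun t ht => hbusy t ht.1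
      littleIdle := fun t ht => hlittle t ht.1
      s_mono := fun π t ht u hu htu => limitProcess_mono (hgs0 π) (hgs1 π) ht.1 htu
      y_mono := fun n t ht u hu htu => limitProcess_mono (hgy0 n) (hgyC n) ht.1 htu
      q_ac := fun n t ht => ?_
      a_ac := fun n t ht => ha_ac n t
      y_ac := fun n t ht => hy_ac n t ht.1
      s_ac := fun π t ht => hs_ac π t ht.1
      idling := fun t hreg n hpos => ?_
      maxWeight := fun t hreg π hρ => ?_ }
  · have hconst : AbsolutelyContinuousOnInterval (fun _ : ℝ => q0 n) 0 t :=
      (LipschitzWith.const (q0 n)).lipschitzOnWith.absolutelyContinuousOnInterval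
    have hsum := absolutelyContinuousOnInterval_sum Finset.univ (fun (π : S) _ =>
      (hs_ac π t ht.1).const_mul ((π : Fin N → ℝ) n))
    convert! ((hconst.add (ha_ac n t)).sub hsum).add (hy_ac n t ht.1) using 1
    ext u
    simp [hq_apply, a, mul_comm]
  -- Near `t` the discrete queue exceeds `q t n / 2`, hence `C * step m`, which is the most that one
  -- step can serve; so nothing is wasted.
  · obtain ⟨δ, hδ, hev⟩ := hnear t hreg.1.1.le (q t n / 2) (half_pos hpos)
    refine deriv_limitProcess_eq_zero (hgy0 n) (hgyC n) hreg.1.1 hδ ?_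
    have hsmall : ∀ᶠ m in (hyperfilter ℕ : Filter ℕ), step m < q t n / (2 * C) :=
      tendsto_inv_add_one_hyperfilter.eventually (gt_mem_nhds (by positivity))
    filter_upwards [hev, hsmall] with m hm hsm u v hu hut hvt j hj
    have h1 := (abs_lt.1 (hm u v hu hut hvt j hj n)).1
    have h2 : C * step m ≤ Q m j n := by
      rw [lt_div_iff₀ (by positivity)] at hsm
      linarith
    have h3 : C ≤ Q m j n / step m := (le_div_iff₀ (hstep m)).2 h2
    have h4 := hCS _ (sched (Q m j)).2 n
    have h5 : (0 : ℝ) ≤ lam n := hlam n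
    exact max_eq_right (by linarith)
  · obtain ⟨ρ, hρ, hlt⟩ := hρ
    have ht0 := hreg.1.1.le
    -- By continuity of the weights `ρ` still outweighs `π` at all states near `q t`, so the
    -- scheduling rule never selects `π` during the window.
    have hcont : ContinuousWithinAt (fun x : Fin N → ℝ =>
        ρ ⬝ᵥ weight f x - (π : Fin N → ℝ) ⬝ᵥ weight f x) {x | 0 ≤ x} (q t) :=
      ((continuous_dotProduct_right ρ).comp_continuousOn hf.continuousOn_weight).sub
        ((continuous_dotProduct_right _).comp_continuousOn hf.continuousOn_weight) _
        (hq_nonneg t ht0)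
    have hmem := hcont.eventually (lt_mem_nhds (sub_pos.2 hlt))
    obtain ⟨r, hr, hball⟩ := Metric.mem_nhdsWithin_iff.1 hmem
    obtain ⟨δ, hδ, hev⟩ := hnear t ht0 r hr
    refine deriv_limitProcess_eq_zero (hgs0 π) (hgs1 π) hreg.1.1 hδ ?_
    filter_upwards [hev] with m hm u v hu hut hvt j hj
    refine if_neg fun heq => ?_
    have h1 : Q m j ∈ Metric.ball (q t) r := by
      rw [Metric.mem_ball, dist_pi_lt_iff hr]
      exact fun n => by
        rw [Real.dist_eq]
        exact hm u v hu hut hvt j hj n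
    have h2 : 0 < ρ ⬝ᵥ weight f (Q m j) - (π : Fin N → ℝ) ⬝ᵥ weight f (Q m j) :=
      hball ⟨h1, fun n => hQ0 m j n⟩
    have h3 := (hsched (Q m j)).2 ρ hρ
    rw [heq] at h3
    exact absurd h3 (not_le.2 (sub_pos.1 h2))

end

end SwitchedNetwork

end

/-! ### Assembly of the theorem. -/

theorem theorem5p4 {N : ℕ} (S : Finset (Fin N → ℝ))
    (hS : ∀ π ∈ S, 0 ≤ π) (hserve : ∀ n, ∃ π ∈ S, 0 < π n)
    (f : ℝ → ℝ) (hf : SwitchedNetwork.WeightFunction S f)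
    (lam : Fin N → ℝ) (hlam : lam ∈ SwitchedNetwork.admissibleRegion S) :
    -- the lifting map is well defined
    (∀ q : Fin N → ℝ, 0 ≤ q →
      SwitchedNetwork.IsLiftOptimizer S lam f q (SwitchedNetwork.liftingMap S lam f q) ∧
      ∀ r, SwitchedNetwork.IsLiftOptimizer S lam f q r →
        r = SwitchedNetwork.liftingMap S lam f q) ∧
    -- (i)
    ((∀ K : ℝ, IsCompact {q : Fin N → ℝ | 0 ≤ q ∧ SwitchedNetwork.lyapunov f q ≤ K}) ∧
      ∀ T : ℝ≥0∞, 0 < T → ∀ (q a y : ℝ → Fin N → ℝ) (s : S → ℝ → ℝ),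
        SwitchedNetwork.IsFluidSolution S lam f T q a y s →
        AntitoneOn (fun t => SwitchedNetwork.lyapunov f (q t)) (SwitchedNetwork.horizon T)) ∧
    -- (ii)
    ContinuousOn (SwitchedNetwork.liftingMap S lam f) {q | 0 ≤ q} ∧
    -- (iii)
    (∀ q : Fin N → ℝ, 0 ≤ q → ∀ κ : ℝ, 0 < κ →
      SwitchedNetwork.liftingMap S lam f (κ • q) = κ • SwitchedNetwork.liftingMap S lam f q) ∧
    -- (iv)
    (∀ T : ℝ≥0∞, 0 < T → ∀ q0 : Fin N → ℝ, 0 ≤ q0 →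
      (SwitchedNetwork.IsInvariantState S lam f T q0 ↔
        q0 = SwitchedNetwork.liftingMap S lam f q0)) ∧
    -- (v)
    (∀ ε : ℝ, 0 < ε → ∃ H : ℝ, ∀ T : ℝ≥0∞, 0 < T →
      ∀ (q a y : ℝ → Fin N → ℝ) (s : S → ℝ → ℝ),
        SwitchedNetwork.IsFluidSolution S lam f T q a y s → ‖q 0‖ ≤ 1 →
        ∀ t ∈ SwitchedNetwork.horizon T, H ≤ t →
          ‖q t - SwitchedNetwork.liftingMap S lam f (q t)‖ < ε) := by
  refine ⟨fun q hq => ⟨hf.isLiftOptimizer_liftingMap hq, fun r hr => hf.eq_liftingMap hr hq⟩,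
    ⟨hf.isCompact_sublevel, fun T _ q a y s h => h.antitoneOn_lyapunov hf hlam⟩,
    hf.continuousOn_liftingMap, fun q hq κ hκ => hf.liftingMap_smul hS hserve hlam hq hκ,
    fun T hT q0 hq0 => ⟨fun hinv => ?_, fun hfix q a y s h h0 t ht => ?_⟩, fun ε hε => ?_⟩
  -- Existence of a solution from `q0` is what gives invariance content: that solution is
  -- stationary, and a stationary state must be balanced, as otherwise `L` would decrease.
  · obtain ⟨q, a, y, s, hsol, h0⟩ := SwitchedNetwork.exists_isFluidSolution hf hS
      (SwitchedNetwork.nonempty_of_mem_admissibleRegion hlam) hlam.1 hq0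
    exact (hf.eq_liftingMap_self_iff hS hserve hlam hq0).2
      ((hsol T).isBalanced_of_stationary hf hT (hinv q a y s (hsol T) h0))
  · rw [← h0] at hfix ⊢
    exact h.eq_initial_of_eq_liftingMap hf hS hlam hfix ht
  -- The initial states allowed form a compact set, so `L` is bounded on them by a single `B`, and
  -- the time bound depends on `B` and `ε` alone among the data of the solution.
  · have hK : IsCompact (Metric.closedBall (0 : Fin N → ℝ) 1 ∩ Set.Ici 0) :=
      (isCompact_closedBall 0 1).inter_right isClosed_Ici
    obtain ⟨B, hB⟩ := hK.bddAbove_image (hf.continuousOn_lyapunov.mono Set.inter_subset_right)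
    obtain ⟨H, hH⟩ := SwitchedNetwork.exists_time_norm_sub_liftingMap_lt hf hS hserve hlam B hε
    refine ⟨H, fun T _ q a y s h hq t ht hHt => hH T q a y s h (hB ⟨q 0, ⟨?_, ?_⟩, rfl⟩) t ht hHt⟩
    · rwa [mem_closedBall_zero_iff]
    · exact h.q_nonneg 0 SwitchedNetwork.zero_mem_horizon
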